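/- Let $w_1,w_2\in\mathbb C$ with $w_1w_2\ne0$ and $\arg w_1\neq\arg w_2$ (arguments modulo $2\pi$), and put $W=\operatorname{diag}\{w_1,w_2\}$. Let $T\in\mathbb C^{2\times2}$ be an orthogonal projector, $T=T^\dagger=T^2$, and put $T^\perp=I-T$. For a matrix function $Q:(0,1)\to\mathbb C^{2\times 2}$ with entries in $L_1(0,1)$, consider the boundary value problem $L(Q,W,T)$: $$-Y''+Q(x)Y=\lambda WY,\quad x\in(0,1),\qquad Y(0)=0,\qquad V(Y):=TY'(1)-T^\perp Y(1)=0.$$ Here a (vector or matrix) solution is a function $Y$ that is differentiable on $[0,1]$, with $Y'$ absolutely continuous on $[0,1]$, and that satisfies the equation almost everywhere; an eigenvalue of $L(Q,W,T)$ is a $\lambda\in\mathbb C$ for which the problem has a vector solution that is not identically zero. For $\lambda\in\mathbb C$ that is not an eigenvalue, let $\Phi(x,\lambda)$ be the Weyl solution, i.e. the $2\times2$ matrix solution of the equation with $\Phi(0,\lambda)=I$ and $V(\Phi)=0$, and let $M(\lambda)=\Phi'(0,\lambda)$ be the Weyl matrix of $L(Q,W,T)$. Let $Q$ and $\tilde Q$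 be two such potentials, and let $M$ and $\tilde M$ be the Weyl matrices of $L(Q,W,T)$ and $L(\tilde Q,W,T)$, with the same $W$ and $T$. If $M(\lambda)=\tilde M(\lambda)$ for every $\lambda\in\mathbb C$ that is an eigenvalue of neither problem, then $Q(x)=\tilde Q(x)$ for almost every $x\in(0,1)$. -/

import Mathlib

open MeasureTheory Set
open scoped Matrix

/-- The derivative on the closed interval `[0, 1]` (one-sided at the end points) of a matrix
function, taken entry by entry. -/
noncomputable def matDeriv {n : Type} (Y : ℝ → Matrix (Fin 2) n ℂ) (x : ℝ) :
    Matrix (Fin 2) n ℂ :=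
  Matrix.of fun i j => derivWithin (fun t => Y t i j) (Icc 0 1) x

/-- `Y` is a (Carathéodory) solution of `-Y'' + Q(x) Y = z W Y` on `(0, 1)`, `W = diag (w 0, w 1)`:
`Y` is differentiable on `[0, 1]`, `Y'` is absolutely continuous on `[0, 1]`, and the equation
holds almost everywhere. The columns of `Y` are indexed by `n`: a vector solution has one column,
a matrix solution has two. -/
structure IsSLSolution {n : Type} (Q : ℝ → Matrix (Fin 2) (Fin 2) ℂ) (w : Fin 2 → ℂ) (z : ℂ)
    (Y : ℝ → Matrix (Fin 2) n ℂ) : Prop where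
  differentiableOn : ∀ i j, DifferentiableOn ℝ (fun x => Y x i j) (Icc 0 1)
  absolutelyContinuous : ∀ i j, AbsolutelyContinuousOnInterval (fun x => matDeriv Y x i j) 0 1
  equation : ∀ᵐ x ∂(volume.restrict (Ioo (0 : ℝ) 1)), ∀ i j,
    DifferentiableAt ℝ (fun t => matDeriv Y t i j) x ∧
      -deriv (fun t => matDeriv Y t i j) x + (Q x * Y x) i j
        = z * (Matrix.diagonal w * Y x) i j

/-- The boundary form `V(Y) = T Y'(1) - T^⊥ Y(1)`, where `T^⊥ = I - T`. -/
noncomputable def boundaryForm {n : Type} (T : Matrix (Fin 2) (Fin 2) ℂ)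
    (Y : ℝ → Matrix (Fin 2) n ℂ) : Matrix (Fin 2) n ℂ :=
  T * matDeriv Y 1 - (1 - T) * Y 1

/-- `z` is an eigenvalue of the problem `-Y'' + Q(x) Y = z W Y`, `Y(0) = 0`, `V(Y) = 0`:
there is a vector solution that does not vanish identically on `[0, 1]`. -/
def IsSLEigenvalue (Q : ℝ → Matrix (Fin 2) (Fin 2) ℂ) (w : Fin 2 → ℂ)
    (T : Matrix (Fin 2) (Fin 2) ℂ) (z : ℂ) : Prop :=
  ∃ Y : ℝ → Matrix (Fin 2) Unit ℂ, IsSLSolution Q w z Y ∧ Y 0 = 0 ∧ boundaryForm T Y = 0 ∧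
    ∃ x ∈ Icc (0 : ℝ) 1, Y x ≠ 0

/-- `Φ` is the Weyl solution at the spectral parameter `z`: the `2 × 2` matrix solution with
`Φ(0) = I` and `V(Φ) = 0`. -/
structure IsWeylSolution (Q : ℝ → Matrix (Fin 2) (Fin 2) ℂ) (w : Fin 2 → ℂ)
    (T : Matrix (Fin 2) (Fin 2) ℂ) (z : ℂ) (Φ : ℝ → Matrix (Fin 2) (Fin 2) ℂ) : Prop where
  solution : IsSLSolution Q w z Φ
  initial : Φ 0 = 1
  boundary : boundaryForm T Φ = 0

open Classical in
/-- The Weyl matrix `M(z) = Φ'(0, z)`. For every `z` that is not an eigenvalue the Weyl solution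
exists and is unique; at an eigenvalue (a pole of `M`) there is none, and the value is irrelevant.
-/
noncomputable def weylMatrix (Q : ℝ → Matrix (Fin 2) (Fin 2) ℂ) (w : Fin 2 → ℂ)
    (T : Matrix (Fin 2) (Fin 2) ℂ) (z : ℂ) : Matrix (Fin 2) (Fin 2) ℂ :=
  if h : ∃ Φ, IsWeylSolution Q w T z Φ then matDeriv h.choose 0 else 0

/-! Write the equation as a first order system for (Y, Y') with fundamental matrix Ψ(x, z), Ψ(0, z)
= I, and compare the two potentials through the transfer matrix P = Ψ Ψ̃⁻¹. For fixed x it is entire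
in z, and its upper block row grows at most like exp(B |z|^(1/2)) (`exists_norm_transfer_le`). It
suffices that this row is (I, 0): the upper halves of Ψ and Ψ̃ then agree, and two differentiations
give Q = Q̃ (`SolvesLinearODE.ae_eq_of_toRows_eq`).

The Weyl matrix enters because P can be computed from any common initial data. Let Z hold the Cauchy
data at 0 of Φ and of the solution S with S(0) = 0, S'(0) = I, suitably normalized. Equality of the
Weyl matrices makes Z the same for both problems, and P = (ΨZ)(Ψ̃Z)⁻¹. On a ray where the two
exponents κ_i = (-z w_i)^(1/2) have the same positive real part, S is purely growing and Φ purely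
decaying to leading order. There ΨZ and Ψ̃Z share their leading term, so the upper row of P tends to
(I, 0) (`tendsto_split_transfer`, `tendsto_transfer`).

Equal real parts matter twice. The perturbation error is e^(sx) O(1/s) in norm, which is negligible
against every growing component only if all of them have size e^(sx). And the normalized initial
values of the solutions satisfying the right boundary condition then converge to -(KT + T^⊥), which
is invertible because the numerical range of K = diag κ lies in the right half plane
(`isUnit_diagonal_mul_add`).

Distinct arguments of w₁, w₂ provide two such rays (`exists_two_rays`). One ray would leave a sector
of opening 2π, critical for order 1/2: cos √z is bounded on the positive half line. Two rays leave
sectors of smaller opening, where Phragmén–Lindelöf bounds the entries of the upper row; Liouville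
makes them constant, equal to their limit (`eq_of_tendsto_on_two_rays`). -/

set_option linter.unusedSectionVars false
-- Absolute continuity and Grönwall's inequality with an L₁ coefficient.
section AbsolutelyContinuous

open Filter Topology AbsolutelyContinuousOnInterval

/-- Absolute continuity passes to functions with smaller increments. -/
theorem AbsolutelyContinuousOnInterval.of_dist_le {X Y : Type*} [PseudoMetricSpace X]
    [PseudoMetricSpace Y] {f : ℝ → X} {g : ℝ → Y} {a b : ℝ}
    (hg : AbsolutelyContinuousOnInterval g a b)
    (h : ∀ x ∈ uIcc a b, ∀ y ∈ uIcc a b, dist (f x) (f y) ≤ dist (g x) (g y)) :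
    AbsolutelyContinuousOnInterval f a b := by
  unfold AbsolutelyContinuousOnInterval at hg ⊢
  refine squeeze_zero' (Eventually.of_forall fun _ => Finset.sum_nonneg fun _ _ => dist_nonneg)
    ?_ hg
  rw [eventually_inf_principal]
  filter_upwards with E hE
  exact Finset.sum_le_sum fun i hi => h _ (hE.1 i hi).1 _ (hE.1 i hi).2

variable {F : Type*} [NormedAddCommGroup F] [NormedSpace ℝ F]

theorem IntervalIntegrable.absolutelyContinuousOnInterval_integral {f : ℝ → F} {a b : ℝ}
    (hf : IntervalIntegrable f volume a b) :
    AbsolutelyContinuousOnInterval (fun x => ∫ t in a..x, f t) a b := by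
  refine (hf.norm.absolutelyContinuousOnInterval_intervalIntegral left_mem_uIcc).of_dist_le ?_
  intro x hx y hy
  have key : ∀ {x}, x ∈ uIcc a b → IntervalIntegrable f volume a x := fun hx =>
    hf.mono_set (uIcc_subset_uIcc_left hx)
  rw [dist_comm, dist_comm (∫ t in a..x, ‖f t‖), dist_eq_norm, dist_eq_norm,
    intervalIntegral.integral_interval_sub_left (key hy) (key hx),
    intervalIntegral.integral_interval_sub_left (key hy).norm (key hx).norm, Real.norm_eq_abs]
  exact intervalIntegral.norm_integral_le_abs_integral_norm

variable [CompleteSpace F]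

/-- Subtracting the primitive of f' from f leaves an absolutely continuous function with derivative
zero almost everywhere, hence a constant. -/
theorem AbsolutelyContinuousOnInterval.integral_eq_sub_of_ae_hasDerivAt {f f' : ℝ → F} {a b : ℝ}
    (hf : AbsolutelyContinuousOnInterval f a b) (hf' : IntervalIntegrable f' volume a b)
    (h : ∀ᵐ x, x ∈ uIcc a b → HasDerivAt f (f' x) x) :
    ∫ x in a..b, f' x = f b - f a := by
  have hg := hf.sub hf'.absolutelyContinuousOnInterval_integral
  obtain ⟨C, hC⟩ := hg.const_of_ae_hasDerivAt_zero (by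
    filter_upwards [h, hf'.ae_hasDerivAt_integral] with x h1 h2 hx
    simpa using (h1 hx).sub (h2 hx a left_mem_uIcc))
  have h1 := hC a left_mem_uIcc
  have h2 := hC b right_mem_uIcc
  simp only [Pi.sub_apply, intervalIntegral.integral_same, sub_zero] at h1 h2
  rw [h1, ← h2]; abel

/-- Grönwall's inequality with an integrable coefficient. -/
theorem le_mul_exp_of_le_add_integral {u g : ℝ → ℝ} {b c : ℝ} (hb : 0 ≤ b)
    (hu : ContinuousOn u (Icc 0 b)) (hg : IntervalIntegrable g volume 0 b) (hg0 : ∀ x, 0 ≤ g x)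
    (h : ∀ x ∈ Icc 0 b, u x ≤ c + ∫ t in (0 : ℝ)..x, g t * u t) :
    u b ≤ c * Real.exp (∫ t in (0 : ℝ)..b, g t) := by
  have hI : uIcc 0 b = Icc 0 b := uIcc_of_le hb
  have hgu : IntervalIntegrable (fun t => g t * u t) volume 0 b :=
    hg.mul_continuousOn (by rwa [hI])
  have hac1 : AbsolutelyContinuousOnInterval (fun x => c + ∫ t in (0 : ℝ)..x, g t * u t) 0 b :=
    hgu.absolutelyContinuousOnInterval_integral.of_dist_le fun x _ y _ => by simp
  have hGnn : ∀ x ∈ uIcc 0 b, 0 ≤ ∫ t in (0 : ℝ)..x, g t := fun x hx =>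
    intervalIntegral.integral_nonneg (by rw [hI] at hx; exact hx.1) fun t _ => hg0 t
  have hac2 : AbsolutelyContinuousOnInterval
      (fun x => Real.exp (-∫ t in (0 : ℝ)..x, g t)) 0 b := by
    refine hg.absolutelyContinuousOnInterval_integral.of_dist_le fun x hx y hy => ?_
    -- On nonnegative arguments exp(-·) is 1-Lipschitz, so exp(-∫ g) inherits the absolute
    -- continuity of ∫ g.
    have aux : ∀ p q : ℝ, 0 ≤ p → p ≤ q → |Real.exp (-p) - Real.exp (-q)| ≤ |p - q| := by
      intro p q hp hpq
      have h1 : Real.exp (-q) ≤ Real.exp (-p) := Real.exp_le_exp.2 (by linarith)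
      rw [abs_of_nonneg (by linarith), abs_of_nonpos (by linarith)]
      have h2 : Real.exp (-q) = Real.exp (-p) * Real.exp (p - q) := by
        rw [← Real.exp_add]; ring_nf
      have h3 := Real.add_one_le_exp (p - q)
      have h4 : Real.exp (-p) ≤ 1 := Real.exp_le_one_iff.2 (by linarith)
      have h5 := Real.exp_pos (-p)
      rw [h2]; nlinarith
    rw [Real.dist_eq, Real.dist_eq]
    rcases le_total (∫ t in (0 : ℝ)..x, g t) (∫ t in (0 : ℝ)..y, g t) with hxy | hxy
    · exact aux _ _ (hGnn x hx) hxy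
    · rw [abs_sub_comm, abs_sub_comm (∫ t in (0 : ℝ)..x, g t)]
      exact aux _ _ (hGnn y hy) hxy
  have hac := hac1.mul hac2
  -- The derivative of (c + ∫ g u) exp(-∫ g) is g (u - c - ∫ g u) exp(-∫ g), which is nonpositive
  -- almost everywhere by `h`.
  have hle := intervalIntegral.integral_nonneg_of_ae_restrict (μ := volume) hb
    (f := fun x => -deriv ((fun x => c + ∫ t in (0 : ℝ)..x, g t * u t) *
      fun x => Real.exp (-∫ t in (0 : ℝ)..x, g t)) x) (by
      rw [EventuallyLE, ae_restrict_iff' measurableSet_Icc]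
      filter_upwards [hgu.ae_hasDerivAt_integral, hg.ae_hasDerivAt_integral] with x h1 h2 hx
      rw [← hI] at hx
      have h3 := ((h1 hx 0 left_mem_uIcc).const_add c).mul (h2 hx 0 left_mem_uIcc).neg.exp
      simp only [Pi.neg_apply] at h3
      rw [h3.deriv]
      have h4 := h x (hI ▸ hx)
      have h5 := mul_nonneg (hg0 x) (sub_nonneg.2 h4)
      have h6 := Real.exp_pos (-∫ t in (0 : ℝ)..x, g t)
      simp only [Pi.zero_apply]
      nlinarith [mul_nonneg h5 h6.le])
  rw [intervalIntegral.integral_neg, hac.integral_deriv_eq_sub] at hle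
  simp only [Pi.mul_apply, intervalIntegral.integral_same, add_zero, neg_zero, Real.exp_zero,
    mul_one, neg_sub, sub_nonneg] at hle
  refine (h b ⟨hb, le_rfl⟩).trans ?_
  rwa [Real.exp_neg, mul_inv_le_iff₀ (Real.exp_pos _)] at hle

end AbsolutelyContinuous

/-! ### Entrywise continuity and integration of matrix functions. -/

section MatrixIntegral

theorem intervalIntegrable_fun_sum {ι E : Type*} [NormedAddCommGroup E] (s : Finset ι)
    {f : ι → ℝ → E} {a b : ℝ} (h : ∀ i ∈ s, IntervalIntegrable (f i) volume a b) :
    IntervalIntegrable (fun t => ∑ i ∈ s, f i t) volume a b := by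
  have := IntervalIntegrable.sum s h
  rwa [Finset.sum_fn] at this

open scoped Matrix.Norms.L2Operator

variable {m n k : Type*} [Fintype m] [Fintype n] [Fintype k] [DecidableEq m] [DecidableEq n]
  [DecidableEq k] {a b : ℝ}

theorem Matrix.continuousOn_iff_entry {u : ℝ → Matrix m n ℂ} {s : Set ℝ} :
    ContinuousOn u s ↔ ∀ i j, ContinuousOn (fun t => u t i j) s := by
  refine ⟨fun h i j => ?_, fun h => ?_⟩
  · exact (continuous_id.matrix_elem i j).comp_continuousOn h
  · exact continuousOn_pi.2 fun i => continuousOn_pi.2 fun j => h i j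

theorem Matrix.intervalIntegrable_iff_entry {u : ℝ → Matrix m n ℂ} :
    IntervalIntegrable u volume a b ↔ ∀ i j, IntervalIntegrable (fun t => u t i j) volume a b := by
  classical
  refine ⟨fun h i j => ?_, fun h => ?_⟩
  · let L := LinearMap.toContinuousLinearMap (Matrix.entryLinearMap (m := m) (n := n) ℂ ℂ i j)
    exact ⟨L.integrable_comp h.1, L.integrable_comp h.2⟩
  · have : u = fun t => ∑ i, ∑ j, u t i j • Matrix.single i j (1 : ℂ) := by
      funext t
      conv_lhs => rw [Matrix.matrix_eq_sum_single (u t)]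
      simp [Matrix.smul_single]
    rw [this]
    refine intervalIntegrable_fun_sum _ fun i _ => intervalIntegrable_fun_sum _ fun j _ => ?_
    exact ⟨(h i j).1.smul_const _, (h i j).2.smul_const _⟩

theorem Matrix.intervalIntegral_entry {u : ℝ → Matrix m n ℂ} (hu : IntervalIntegrable u volume a b)
    (i : m) (j : n) : (∫ t in a..b, u t) i j = ∫ t in a..b, u t i j :=
  ((LinearMap.toContinuousLinearMap
    (Matrix.entryLinearMap ℂ ℂ i j)).intervalIntegral_comp_comm hu).symm

theorem Matrix.intervalIntegral_mul_const {u : ℝ → Matrix m n ℂ}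
    (hu : IntervalIntegrable u volume a b) (c : Matrix n k ℂ) :
    (∫ t in a..b, u t * c) = (∫ t in a..b, u t) * c :=
  (LinearMap.toContinuousLinearMap (mulRightLinearMap m ℂ c)).intervalIntegral_comp_comm hu

theorem Matrix.intervalIntegral_const_mul {u : ℝ → Matrix n k ℂ}
    (hu : IntervalIntegrable u volume a b) (c : Matrix m n ℂ) :
    (∫ t in a..b, c * u t) = c * (∫ t in a..b, u t) :=
  (LinearMap.toContinuousLinearMap (mulLeftLinearMap k ℂ c)).intervalIntegral_comp_comm hu

theorem Matrix.intervalIntegrable_mul {A : ℝ → Matrix m n ℂ} {u : ℝ → Matrix n k ℂ}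
    (hA : IntervalIntegrable A volume a b) (hu : ContinuousOn u (uIcc a b)) :
    IntervalIntegrable (fun t => A t * u t) volume a b := by
  rw [Matrix.intervalIntegrable_iff_entry] at hA ⊢
  rw [Matrix.continuousOn_iff_entry] at hu
  intro i j
  simp only [Matrix.mul_apply]
  exact intervalIntegrable_fun_sum _ fun l _ => (hA i l).mul_continuousOn (hu l j)

end MatrixIntegral

/-! ### Linear systems with integrable coefficients: uniqueness, bounds, invertibility. -/

section LinearODE

open scoped Matrix.Norms.L2Operator

variable {m n k : Type*} [Fintype m] [Fintype n] [Fintype k] [DecidableEq m] [DecidableEq n]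
  [DecidableEq k] {a b : ℝ}

/-- `u` is a Carathéodory solution of `u' = A u` on `[0, b]`. -/
structure SolvesLinearODE (A : ℝ → Matrix m m ℂ) (b : ℝ) (u : ℝ → Matrix m n ℂ) : Prop where
  continuousOn : ContinuousOn u (Icc 0 b)
  eq : ∀ x ∈ Icc 0 b, u x = u 0 + ∫ t in (0 : ℝ)..x, A t * u t

namespace SolvesLinearODE

variable {A : ℝ → Matrix m m ℂ} {u v : ℝ → Matrix m n ℂ}

theorem intervalIntegrable_mul (h : SolvesLinearODE A b u) (hA : IntervalIntegrable A volume 0 b)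
    {x y : ℝ} (hx : x ∈ Icc 0 b) (hy : y ∈ Icc 0 b) :
    IntervalIntegrable (fun t => A t * u t) volume x y := by
  have hb : (0 : ℝ) ≤ b := hx.1.trans hx.2
  have hs : uIcc x y ⊆ Icc 0 b := uIcc_subset_Icc hx hy
  exact Matrix.intervalIntegrable_mul (hA.mono_set (by rwa [uIcc_of_le hb])) (h.continuousOn.mono hs)

theorem mono (h : SolvesLinearODE A b u) (hab : a ≤ b) : SolvesLinearODE A a u :=
  ⟨h.continuousOn.mono (Icc_subset_Icc_right hab), fun x hx => h.eq x ⟨hx.1, hx.2.trans hab⟩⟩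

theorem mul_right (h : SolvesLinearODE A b u) (hA : IntervalIntegrable A volume 0 b)
    (c : Matrix n k ℂ) : SolvesLinearODE A b (fun x => u x * c) := by
  refine ⟨?_, fun x hx => ?_⟩
  · exact (Continuous.matrix_mul continuous_id continuous_const).comp_continuousOn h.continuousOn
  · conv_lhs => rw [h.eq x hx]
    have hi := h.intervalIntegrable_mul hA (left_mem_Icc.2 (hx.1.trans hx.2)) hx
    simp only [← Matrix.mul_assoc]
    rw [Matrix.add_mul, Matrix.intervalIntegral_mul_const hi]

theorem sub (h : SolvesLinearODE A b u) (h' : SolvesLinearODE A b v)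
    (hA : IntervalIntegrable A volume 0 b) : SolvesLinearODE A b (fun x => u x - v x) := by
  refine ⟨h.continuousOn.sub h'.continuousOn, fun x hx => ?_⟩
  have h0 := left_mem_Icc.2 (hx.1.trans hx.2)
  conv_lhs => rw [h.eq x hx, h'.eq x hx]
  simp only [Matrix.mul_sub]
  rw [intervalIntegral.integral_sub (h.intervalIntegrable_mul hA h0 hx)
    (h'.intervalIntegrable_mul hA h0 hx)]
  abel

theorem norm_le (h : SolvesLinearODE A b u) (hb : 0 ≤ b) (hA : IntervalIntegrable A volume 0 b) :
    ‖u b‖ ≤ ‖u 0‖ * Real.exp (∫ t in (0 : ℝ)..b, ‖A t‖) := by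
  refine le_mul_exp_of_le_add_integral hb h.continuousOn.norm hA.norm (fun _ => norm_nonneg _)
    fun x hx => ?_
  have h0 := left_mem_Icc.2 (hx.1.trans hx.2)
  calc ‖u x‖ ≤ ‖u 0‖ + ‖∫ t in (0 : ℝ)..x, A t * u t‖ := by
        conv_lhs => rw [h.eq x hx]
        exact norm_add_le _ _
    _ ≤ ‖u 0‖ + ∫ t in (0 : ℝ)..x, ‖A t‖ * ‖u t‖ := by
        gcongr
        refine intervalIntegral.norm_integral_le_of_norm_le hx.1
          (Filter.Eventually.of_forall fun t _ => Matrix.l2_opNorm_mul _ _) ?_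
        have hs : uIcc 0 x ⊆ uIcc 0 b := by
          rw [uIcc_of_le hb]; exact uIcc_subset_Icc h0 hx
        exact (hA.mono_set hs).norm.mul_continuousOn
          (h.continuousOn.norm.mono (by rwa [uIcc_of_le hb] at hs))

theorem eqOn (h : SolvesLinearODE A b u) (h' : SolvesLinearODE A b v)
    (hA : IntervalIntegrable A volume 0 b) (h0 : u 0 = v 0) {x : ℝ} (hx : x ∈ Icc 0 b) :
    u x = v x := by
  have := ((h.sub h' hA).mono hx.2).norm_le hx.1 (hA.mono_set (by
    rw [uIcc_of_le hx.1, uIcc_of_le (hx.1.trans hx.2)]; exact Icc_subset_Icc_right hx.2))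
  rw [h0, sub_self, norm_zero, zero_mul] at this
  exact sub_eq_zero.1 (norm_le_zero_iff.1 this)

/-- Reversal of the interval. -/
theorem reflect (h : SolvesLinearODE A b u) (hA : IntervalIntegrable A volume 0 b) :
    SolvesLinearODE (fun t => -A (b - t)) b (fun x => u (b - x)) := by
  have hmem : ∀ x ∈ Icc 0 b, b - x ∈ Icc 0 b := fun x hx =>
    ⟨sub_nonneg.2 hx.2, by linarith [hx.1]⟩
  refine ⟨h.continuousOn.comp (by fun_prop) hmem, fun x hx => ?_⟩
  have h0 := left_mem_Icc.2 (hx.1.trans hx.2)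
  have hbb := right_mem_Icc.2 (hx.1.trans hx.2)
  simp only [Matrix.neg_mul]
  rw [intervalIntegral.integral_neg,
    intervalIntegral.integral_comp_sub_left (fun t => A t * u t) b, sub_zero,
    h.eq _ (hmem x hx), h.eq b hbb, ← intervalIntegral.integral_add_adjacent_intervals
      (h.intervalIntegrable_mul hA h0 (hmem x hx)) (h.intervalIntegrable_mul hA (hmem x hx) hbb)]
  abel

theorem intervalIntegrable_reflect (hA : IntervalIntegrable A volume 0 b) :
    IntervalIntegrable (fun t => -A (b - t)) volume 0 b := by
  have := (hA.comp_sub_left b).symm.neg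
  rwa [sub_self, sub_zero] at this

variable {Ψ : ℝ → Matrix m m ℂ}

/-- If Ψ(b) v = 0, the solution Ψ v run backwards from b starts at zero, so it vanishes and v = Ψ(0)
v = 0. -/
theorem isUnit (h : SolvesLinearODE A b Ψ) (hA : IntervalIntegrable A volume 0 b) (h0 : Ψ 0 = 1)
    (hb : 0 ≤ b) : IsUnit (Ψ b) := by
  rw [Matrix.isUnit_iff_isUnit_det, isUnit_iff_ne_zero]
  intro hdet
  obtain ⟨v, hv, hv0⟩ := Matrix.exists_mulVec_eq_zero_iff.2 hdet
  have h1 := (h.mul_right hA (Matrix.replicateCol Unit v)).reflect hA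
  have h2 := h1.norm_le hb (intervalIntegrable_reflect hA)
  have h3 : Ψ b * Matrix.replicateCol Unit v = 0 := by
    rw [← Matrix.replicateCol_mulVec, hv0]; rfl
  simp only [sub_zero, h3, norm_zero, zero_mul, sub_self, h0, Matrix.one_mul,
    norm_le_zero_iff] at h2
  exact hv (funext fun i => congrFun (congrFun h2 i) ())

/-- The backward solution Ψ(b - x) Ψ(b)⁻¹ starts at the identity and ends at Ψ(b)⁻¹, so the forward
Grönwall bound applies to it. -/
theorem norm_inv_le [Nonempty m] (h : SolvesLinearODE A b Ψ) (hA : IntervalIntegrable A volume 0 b)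
    (h0 : Ψ 0 = 1) (hb : 0 ≤ b) : ‖(Ψ b)⁻¹‖ ≤ Real.exp (∫ t in (0 : ℝ)..b, ‖A t‖) := by
  have h1 := ((h.mul_right hA (Ψ b)⁻¹).reflect hA).norm_le hb (intervalIntegrable_reflect hA)
  have hu := (Matrix.isUnit_iff_isUnit_det _).1 (h.isUnit hA h0 hb)
  simp only [sub_self, h0, sub_zero, Matrix.mul_nonsing_inv _ hu, norm_neg,
    norm_one, one_mul] at h1
  rwa [intervalIntegral.integral_comp_sub_left (fun t => ‖A t‖) b, sub_zero, sub_self] at h1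

theorem eq_mul (h : SolvesLinearODE A b Ψ) (hA : IntervalIntegrable A volume 0 b) (h0 : Ψ 0 = 1)
    (hu : SolvesLinearODE A b u) {x : ℝ} (hx : x ∈ Icc 0 b) : u x = Ψ x * u 0 :=
  hu.eqOn (h.mul_right hA (u 0)) hA (by simp [h0]) hx

/-- Change of the unknown by a constant invertible matrix. -/
theorem conj {u : ℝ → Matrix m n ℂ} (h : SolvesLinearODE A b u)
    (hA : IntervalIntegrable A volume 0 b) {G G' : Matrix m m ℂ} (hG : G' * G = 1) :
    SolvesLinearODE (fun t => G * A t * G') b (fun x => G * u x) := by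
  refine ⟨(Continuous.matrix_mul continuous_const continuous_id).comp_continuousOn h.continuousOn,
    fun x hx => ?_⟩
  conv_lhs => rw [h.eq x hx]
  have hi := h.intervalIntegrable_mul hA (left_mem_Icc.2 (hx.1.trans hx.2)) hx
  rw [Matrix.mul_add, ← Matrix.intervalIntegral_const_mul hi]
  congr 2
  funext t
  rw [Matrix.mul_assoc, Matrix.mul_assoc, ← Matrix.mul_assoc G', hG, Matrix.one_mul]

end SolvesLinearODE

end LinearODE

/-! ### The Volterra equation and entire dependence on the spectral parameter. -/

section Volterra

/-- The invertible element 1 - xⁿ factors as 1 - x times a geometric sum that commutes with it. -/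
theorem isUnit_one_sub_of_norm_pow_lt_one {R : Type*} [NormedRing R] [HasSummableGeomSeries R]
    {x : R} {n : ℕ} (h : ‖x ^ n‖ < 1) : IsUnit (1 - x) := by
  have hu := isUnit_one_sub_of_norm_lt_one h
  rw [← mul_neg_geom_sum] at hu
  have hc : Commute (1 - x) (∑ i ∈ Finset.range n, x ^ i) := by
    rw [Commute, SemiconjBy, mul_neg_geom_sum, geom_sum_mul_neg]
  exact (hc.isUnit_mul_iff.1 hu).1

theorem differentiable_inverse_one_sub {R : Type*} [NormedRing R] [HasSummableGeomSeries R]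
    [NormedAlgebra ℂ R] (a b : R) (h : ∀ z : ℂ, IsUnit (1 - (a + z • b))) :
    Differentiable ℂ fun z : ℂ => Ring.inverse (1 - (a + z • b)) := fun z =>
  DifferentiableAt.inverse (by fun_prop) (h z)

variable {𝔸 : Type*} [NormedRing 𝔸] [NormedAlgebra ℂ 𝔸] [CompleteSpace 𝔸]

theorem integral_mul_pow_integral {g : ℝ → ℝ} {b : ℝ} (hg : IntervalIntegrable g volume 0 b)
    (n : ℕ) : ∫ t in (0 : ℝ)..b, g t * (∫ s in (0 : ℝ)..t, g s) ^ n
      = (∫ s in (0 : ℝ)..b, g s) ^ (n + 1) / (n + 1) := by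
  have hG := hg.absolutelyContinuousOnInterval_integral
  have hpow : ∀ k : ℕ, AbsolutelyContinuousOnInterval
      (fun x => (∫ s in (0 : ℝ)..x, g s) ^ k) 0 b := by
    intro k
    induction k with
    | zero => exact hG.of_dist_le fun x _ y _ => by simp
    | succ k ih => simpa only [pow_succ] using ih.fun_mul hG
  have := (hpow (n + 1)).integral_eq_sub_of_ae_hasDerivAt
    (f' := fun t => (n + 1 : ℝ) * (g t * (∫ s in (0 : ℝ)..t, g s) ^ n))
    ((hg.mul_continuousOn (hpow n).continuousOn).const_mul _) (by
      filter_upwards [hg.ae_hasDerivAt_integral] with x hx hxI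
      have := (hx hxI 0 left_mem_uIcc).pow (n + 1)
      convert! this using 1
      push_cast
      ring)
  rw [intervalIntegral.integral_const_mul] at this
  simp only [intervalIntegral.integral_same, ne_eq, Nat.add_eq_zero_iff, one_ne_zero, and_false,
    not_false_eq_true, zero_pow, sub_zero] at this
  rw [← this]
  field_simp

/-- The integrand of the Volterra operator is integrable. -/
theorem intervalIntegrable_mul_IccExtend {A : ℝ → 𝔸} (hA : IntervalIntegrable A volume 0 1)
    (f : C(Icc (0 : ℝ) 1, 𝔸)) :
    IntervalIntegrable (fun t => A t * IccExtend zero_le_one f t) volume 0 1 :=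
  hA.mul_continuousOn f.continuous.Icc_extend'.continuousOn

theorem intervalIntegrable_zero_of_mem {E : Type*} [NormedAddCommGroup E] {g : ℝ → E}
    (hg : IntervalIntegrable g volume 0 1) (x : Icc (0 : ℝ) 1) :
    IntervalIntegrable g volume 0 x :=
  hg.mono_set (by
    rw [uIcc_of_le x.2.1, uIcc_of_le zero_le_one]; exact Icc_subset_Icc_right x.2.2)

theorem norm_integral_mul_IccExtend_le {A : ℝ → 𝔸} (hA : IntervalIntegrable A volume 0 1)
    (f : C(Icc (0 : ℝ) 1, 𝔸)) {h : ℝ → ℝ} (hh : ContinuousOn h (uIcc 0 1))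
    (hfh : ∀ t : Icc (0 : ℝ) 1, ‖f t‖ ≤ h t) (x : Icc (0 : ℝ) 1) :
    ‖∫ t in (0 : ℝ)..x, A t * IccExtend zero_le_one f t‖ ≤ ∫ t in (0 : ℝ)..x, ‖A t‖ * h t := by
  refine intervalIntegral.norm_integral_le_of_norm_le x.2.1
    (Filter.Eventually.of_forall fun t ht => ?_)
    (intervalIntegrable_zero_of_mem (hA.norm.mul_continuousOn hh) x)
  refine (norm_mul_le _ _).trans ?_
  have htI : t ∈ Icc (0 : ℝ) 1 := ⟨ht.1.le, ht.2.trans x.2.2⟩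
  rw [IccExtend_of_mem _ _ htI]
  exact mul_le_mul_of_nonneg_left (hfh ⟨t, htI⟩) (norm_nonneg _)

theorem continuous_integral_mul_IccExtend {A : ℝ → 𝔸} (hA : IntervalIntegrable A volume 0 1)
    (f : C(Icc (0 : ℝ) 1, 𝔸)) :
    Continuous fun x : Icc (0 : ℝ) 1 => ∫ t in (0 : ℝ)..x, A t * IccExtend zero_le_one f t := by
  have := (intervalIntegrable_mul_IccExtend hA f).absolutelyContinuousOnInterval_integral.continuousOn
  rw [uIcc_of_le zero_le_one, continuousOn_iff_continuous_domRestrict] at this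
  exact this

/-- The Volterra operator `f ↦ ∫ A f` on the continuous functions on `[0, 1]`. -/
noncomputable def volterra (A : ℝ → 𝔸) (hA : IntervalIntegrable A volume 0 1) :
    C(Icc (0 : ℝ) 1, 𝔸) →L[ℂ] C(Icc (0 : ℝ) 1, 𝔸) :=
  LinearMap.mkContinuous
    { toFun := fun f => ⟨fun x => ∫ t in (0 : ℝ)..x, A t * IccExtend zero_le_one f t,
        continuous_integral_mul_IccExtend hA f⟩
      map_add' := fun f g => by
        ext x
        change (∫ t in (0 : ℝ)..x, A t * IccExtend zero_le_one (f + g) t) =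
          (∫ t in (0 : ℝ)..x, A t * IccExtend zero_le_one f t)
            + ∫ t in (0 : ℝ)..x, A t * IccExtend zero_le_one g t
        rw [← intervalIntegral.integral_add
          (intervalIntegrable_zero_of_mem (intervalIntegrable_mul_IccExtend hA f) x)
          (intervalIntegrable_zero_of_mem (intervalIntegrable_mul_IccExtend hA g) x)]
        congr 1
        funext t
        simp [IccExtend, mul_add]
      map_smul' := fun c f => by
        ext x
        change (∫ t in (0 : ℝ)..x, A t * IccExtend zero_le_one (c • f) t) =
          c • ∫ t in (0 : ℝ)..x, A t * IccExtend zero_le_one f t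
        rw [← intervalIntegral.integral_smul]
        congr 1
        funext t
        simp [IccExtend] }
    (∫ t in (0 : ℝ)..1, ‖A t‖) fun f => by
      have h0 : 0 ≤ ∫ t in (0 : ℝ)..1, ‖A t‖ :=
        intervalIntegral.integral_nonneg zero_le_one fun _ _ => norm_nonneg _
      refine (ContinuousMap.norm_le _ (by positivity)).2 fun x => ?_
      refine (norm_integral_mul_IccExtend_le hA f (h := fun _ => ‖f‖) continuousOn_const
        (fun t => f.norm_coe_le_norm t) x).trans ?_
      rw [intervalIntegral.integral_mul_const]
      refine mul_le_mul_of_nonneg_right ?_ (norm_nonneg _)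
      exact intervalIntegral.integral_mono_interval le_rfl x.2.1 x.2.2
        (Filter.Eventually.of_forall fun _ => norm_nonneg _) hA.norm

theorem volterra_apply (A : ℝ → 𝔸) (hA : IntervalIntegrable A volume 0 1)
    (f : C(Icc (0 : ℝ) 1, 𝔸)) (x : Icc (0 : ℝ) 1) :
    volterra A hA f x = ∫ t in (0 : ℝ)..x, A t * IccExtend zero_le_one f t := rfl

/-- Integrating ‖A‖ (∫ ‖A‖)ⁿ produces the next power divided by n + 1, hence the factorials. They
make some power of the operator a contraction however large ∫ ‖A‖ is. -/
theorem norm_volterra_pow_apply_le (A : ℝ → 𝔸) (hA : IntervalIntegrable A volume 0 1) (n : ℕ)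
    (f : C(Icc (0 : ℝ) 1, 𝔸)) (x : Icc (0 : ℝ) 1) :
    ‖((volterra A hA) ^ n) f x‖ ≤ (∫ t in (0 : ℝ)..x, ‖A t‖) ^ n / n.factorial * ‖f‖ := by
  induction n generalizing x with
  | zero => simpa using f.norm_coe_le_norm x
  | succ n ih =>
    rw [pow_succ', mul_apply_eq_comp, volterra_apply]
    refine (norm_integral_mul_IccExtend_le hA _
      (h := fun s => (∫ t in (0 : ℝ)..s, ‖A t‖) ^ n / n.factorial * ‖f‖) ?_ ih x).trans_eq ?_
    · exact ((hA.norm.absolutelyContinuousOnInterval_integral.continuousOn.pow n).div_const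
        _).mul_const _
    · have := integral_mul_pow_integral (intervalIntegrable_zero_of_mem hA x).norm n
      have h2 : (fun t => ‖A t‖ * ((∫ s in (0 : ℝ)..t, ‖A s‖) ^ n / n.factorial * ‖f‖))
          = fun t => (‖A t‖ * (∫ s in (0 : ℝ)..t, ‖A s‖) ^ n) * (‖f‖ / n.factorial) := by
        funext t; ring
      rw [h2, intervalIntegral.integral_mul_const, this, Nat.factorial_succ]
      push_cast
      field_simp

theorem isUnit_one_sub_volterra (A : ℝ → 𝔸) (hA : IntervalIntegrable A volume 0 1) :
    IsUnit (1 - volterra A hA) := by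
  have hlim := FloorSemiring.tendsto_pow_div_factorial_atTop (∫ t in (0 : ℝ)..1, ‖A t‖)
  obtain ⟨n, hn⟩ := (hlim.eventually (gt_mem_nhds (zero_lt_one (α := ℝ)))).exists
  have h0 : ∀ x : Icc (0 : ℝ) 1, 0 ≤ ∫ t in (0 : ℝ)..x, ‖A t‖ := fun x =>
    intervalIntegral.integral_nonneg x.2.1 fun _ _ => norm_nonneg _
  have h01 : 0 ≤ ∫ t in (0 : ℝ)..1, ‖A t‖ := h0 ⟨1, zero_le_one, le_rfl⟩
  have hnorm : ‖(volterra A hA) ^ n‖ < 1 := by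
    refine lt_of_le_of_lt (ContinuousLinearMap.opNorm_le_bound _ (by positivity) fun f => ?_) hn
    refine (ContinuousMap.norm_le _ (by positivity)).2 fun x => ?_
    refine (norm_volterra_pow_apply_le A hA n f x).trans ?_
    gcongr
    · exact h0 x
    · exact intervalIntegral.integral_mono_interval le_rfl x.2.1 x.2.2
        (Filter.Eventually.of_forall fun _ => norm_nonneg _) hA.norm
  exact isUnit_one_sub_of_norm_pow_lt_one
    (R := C(Icc (0 : ℝ) 1, 𝔸) →L[ℂ] C(Icc (0 : ℝ) 1, 𝔸)) hnorm

/-- The linear differential equation `Ψ' = (A + z B) Ψ`, `Ψ(0) = 1` with integrable coefficients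
has a solution that is entire in the parameter `z`. -/
theorem exists_entire_fundamental (A B : ℝ → 𝔸) (hA : IntervalIntegrable A volume 0 1)
    (hB : IntervalIntegrable B volume 0 1) :
    ∃ Ψ : ℂ → ℝ → 𝔸, (∀ z, ContinuousOn (Ψ z) (Icc 0 1)) ∧
      (∀ z, ∀ x ∈ Icc (0 : ℝ) 1, Ψ z x = 1 + ∫ t in (0 : ℝ)..x, (A t + z • B t) * Ψ z t) ∧
      ∀ x, Differentiable ℂ fun z => Ψ z x := by
  have hAB : ∀ z : ℂ, IntervalIntegrable (fun t => A t + z • B t) volume 0 1 := fun z =>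
    hA.add (hB.smul z)
  have hK : ∀ z : ℂ, volterra _ (hAB z) = volterra A hA + z • volterra B hB := by
    intro z
    ext f x
    change (∫ t in (0 : ℝ)..x, (A t + z • B t) * IccExtend zero_le_one f t) =
      (∫ t in (0 : ℝ)..x, A t * IccExtend zero_le_one f t)
        + z • ∫ t in (0 : ℝ)..x, B t * IccExtend zero_le_one f t
    have hBz : IntervalIntegrable (fun t => z • (B t * IccExtend zero_le_one f t)) volume 0 x :=
      (intervalIntegrable_zero_of_mem (intervalIntegrable_mul_IccExtend hB f) x).smul z
    rw [← intervalIntegral.integral_smul, ← intervalIntegral.integral_add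
      (intervalIntegrable_zero_of_mem (intervalIntegrable_mul_IccExtend hA f) x) hBz]
    congr 1
    funext t
    rw [add_mul, smul_mul_assoc]
  -- The operator is affine in z and 1 minus it is always invertible, so this inverse is entire in
  -- operator norm; applying it to 1 and evaluating at x preserves that.
  let R : ℂ → C(Icc (0 : ℝ) 1, 𝔸) →L[ℂ] C(Icc (0 : ℝ) 1, 𝔸) := fun z =>
    Ring.inverse (1 - volterra _ (hAB z))
  have hR : Differentiable ℂ R := by
    have h2 : R = fun z : ℂ => Ring.inverse (1 - (volterra A hA + z • volterra B hB)) :=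
      funext fun z => by rw [← hK]
    rw [h2]
    refine differentiable_inverse_one_sub
      (R := C(Icc (0 : ℝ) 1, 𝔸) →L[ℂ] C(Icc (0 : ℝ) 1, 𝔸)) _ _ fun z => ?_
    rw [← hK]
    exact isUnit_one_sub_volterra _ (hAB z)
  let y : ℂ → C(Icc (0 : ℝ) 1, 𝔸) := fun z => R z 1
  have hy : ∀ z, y z = 1 + volterra _ (hAB z) (y z) := by
    intro z
    have h1 := Ring.mul_inverse_cancel _ (isUnit_one_sub_volterra _ (hAB z))
    have h2 := congrArg (fun L : C(Icc (0 : ℝ) 1, 𝔸) →L[ℂ] C(Icc (0 : ℝ) 1, 𝔸) => L 1) h1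
    exact sub_eq_iff_eq_add.1 h2
  refine ⟨fun z => IccExtend zero_le_one (y z), fun z => (y z).continuous.Icc_extend'.continuousOn,
    fun z x hx => ?_, fun x => ?_⟩
  · change IccExtend zero_le_one (y z) x = _
    rw [IccExtend_of_mem _ _ hx]
    conv_lhs => rw [hy z]
    rfl
  · have : Differentiable ℂ fun z => R z 1 := fun z =>
      (hR z).clm_apply (differentiableAt_const _)
    exact (ContinuousMap.evalCLM ℂ (projIcc (0 : ℝ) 1 zero_le_one x)).differentiable.comp this

end Volterra

/-! ### Equivalence of the second order equation with a first order system. -/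

section SturmLiouville

open scoped Matrix.Norms.L2Operator

/-- The coefficient of the first order system for `(Y, Y')` equivalent to
`-Y'' + Q Y = z W Y`. -/
def slMatrix (Q : ℝ → Matrix (Fin 2) (Fin 2) ℂ) (w : Fin 2 → ℂ) (z : ℂ) (t : ℝ) :
    Matrix (Fin 2 ⊕ Fin 2) (Fin 2 ⊕ Fin 2) ℂ :=
  Matrix.fromBlocks 0 1 (Q t - z • Matrix.diagonal w) 0

variable {n : Type} [Fintype n] [DecidableEq n] {Q : ℝ → Matrix (Fin 2) (Fin 2) ℂ} {w : Fin 2 → ℂ}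
  {z : ℂ}

theorem Matrix.intervalIntegrable_fromBlocks {m₁ m₂ n₁ n₂ : Type*} [Fintype m₁] [Fintype m₂]
    [Fintype n₁] [Fintype n₂] [DecidableEq m₁] [DecidableEq m₂] [DecidableEq n₁] [DecidableEq n₂]
    {A : ℝ → Matrix m₁ n₁ ℂ} {B : ℝ → Matrix m₁ n₂ ℂ} {C : ℝ → Matrix m₂ n₁ ℂ}
    {D : ℝ → Matrix m₂ n₂ ℂ} {a b : ℝ} (hA : IntervalIntegrable A volume a b)
    (hB : IntervalIntegrable B volume a b) (hC : IntervalIntegrable C volume a b)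
    (hD : IntervalIntegrable D volume a b) :
    IntervalIntegrable (fun t => Matrix.fromBlocks (A t) (B t) (C t) (D t)) volume a b := by
  rw [Matrix.intervalIntegrable_iff_entry] at *
  rintro (i | i) (j | j)
  exacts [hA i j, hB i j, hC i j, hD i j]

theorem intervalIntegrable_of_entries
    (hQ : ∀ i j, IntegrableOn (fun x => Q x i j) (Ioo (0 : ℝ) 1) volume) :
    IntervalIntegrable Q volume 0 1 :=
  Matrix.intervalIntegrable_iff_entry.2 fun i j =>
    (intervalIntegrable_iff_integrableOn_Ioo_of_le zero_le_one).2 (hQ i j)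

theorem intervalIntegrable_slMatrix (hQ : IntervalIntegrable Q volume 0 1) (w : Fin 2 → ℂ) (z : ℂ) :
    IntervalIntegrable (slMatrix Q w z) volume 0 1 :=
  Matrix.intervalIntegrable_fromBlocks intervalIntegrable_const intervalIntegrable_const
    (hQ.sub intervalIntegrable_const) intervalIntegrable_const

theorem slMatrix_mul_fromRows (t : ℝ) (Y V : Matrix (Fin 2) n ℂ) :
    slMatrix Q w z t * Matrix.fromRows Y V
      = Matrix.fromRows V ((Q t - z • Matrix.diagonal w) * Y) := by
  simp [slMatrix, Matrix.fromBlocks_mul_fromRows]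

theorem IsSLSolution.solves {Y : ℝ → Matrix (Fin 2) n ℂ} (hQ : IntervalIntegrable Q volume 0 1)
    (h : IsSLSolution Q w z Y) :
    SolvesLinearODE (slMatrix Q w z) 1 (fun x => Matrix.fromRows (Y x) (matDeriv Y x)) := by
  have hI : uIcc (0 : ℝ) 1 = Icc 0 1 := uIcc_of_le zero_le_one
  have hYc : ∀ i j, ContinuousOn (fun x => Y x i j) (Icc 0 1) := fun i j =>
    (h.differentiableOn i j).continuousOn
  have hVc : ∀ i j, ContinuousOn (fun x => matDeriv Y x i j) (Icc 0 1) := fun i j =>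
    hI ▸ (h.absolutelyContinuous i j).continuousOn
  have hc : ContinuousOn (fun x => Matrix.fromRows (Y x) (matDeriv Y x)) (Icc 0 1) := by
    rw [Matrix.continuousOn_iff_entry]
    rintro (i | i) j
    exacts [hYc i j, hVc i j]
  refine ⟨hc, fun x hx => ?_⟩
  have hsub : uIcc 0 x ⊆ uIcc (0 : ℝ) 1 := by
    rw [hI]; exact uIcc_subset_Icc (left_mem_Icc.2 zero_le_one) hx
  have hint : IntervalIntegrable
      (fun t => slMatrix Q w z t * Matrix.fromRows (Y t) (matDeriv Y t)) volume 0 x :=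
    (Matrix.intervalIntegrable_mul (intervalIntegrable_slMatrix hQ w z) (hI ▸ hc)).mono_set hsub
  rw [← sub_eq_iff_eq_add']
  ext i j
  rw [Matrix.intervalIntegral_entry hint]
  rw [Matrix.intervalIntegrable_iff_entry] at hint
  simp only [slMatrix_mul_fromRows] at hint ⊢
  rcases i with i | i
  · simp only [Matrix.sub_apply, Matrix.fromRows_apply_inl]
    refine (intervalIntegral.integral_eq_sub_of_hasDerivAt_of_le hx.1
      ((hYc i j).mono (Icc_subset_Icc_right hx.2)) (fun t ht => ?_) ?_).symm
    · have ht1 : t ∈ Ioo (0 : ℝ) 1 := ⟨ht.1, ht.2.trans_le hx.2⟩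
      exact ((h.differentiableOn i j) t (Ioo_subset_Icc_self ht1)).hasDerivWithinAt.hasDerivAt
        (Icc_mem_nhds ht1.1 ht1.2)
    · exact ((hVc i j).mono (Icc_subset_Icc_right hx.2)).intervalIntegrable_of_Icc hx.1
  -- Unlike Y, the derivative Y' is only absolutely continuous, so this row uses the almost
  -- everywhere form of the fundamental theorem; the two end points are discarded as a null set.
  · simp only [Matrix.sub_apply, Matrix.fromRows_apply_inr]
    refine (((h.absolutelyContinuous i j).mono hsub).integral_eq_sub_of_ae_hasDerivAt
      (by simpa using hint (Sum.inr i) j) ?_).symm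
    have heq := (ae_restrict_iff' measurableSet_Ioo).1 h.equation
    filter_upwards [heq, Measure.ae_ne volume (0 : ℝ), Measure.ae_ne volume (1 : ℝ)]
      with t ht h0 h1 hmem
    have hm := hI ▸ hsub hmem
    obtain ⟨hd, he⟩ := ht ⟨lt_of_le_of_ne hm.1 h0.symm, lt_of_le_of_ne hm.2 h1⟩ i j
    have : deriv (fun t => matDeriv Y t i j) t = ((Q t - z • Matrix.diagonal w) * Y t) i j := by
      rw [Matrix.sub_mul, Matrix.sub_apply, Matrix.smul_mul, Matrix.smul_apply, smul_eq_mul, ← he]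
      ring
    exact this ▸ hd.hasDerivAt

/-- The upper half of a solution of the first order system is a solution of the second order
equation, and the lower half is its derivative. -/
theorem SolvesLinearODE.matDeriv_eq {u : ℝ → Matrix (Fin 2 ⊕ Fin 2) n ℂ}
    (hQ : IntervalIntegrable Q volume 0 1) (h : SolvesLinearODE (slMatrix Q w z) 1 u) (i : Fin 2)
    (j : n) {x : ℝ} (hx : x ∈ Icc (0 : ℝ) 1) :
    HasDerivWithinAt (fun t => u t (Sum.inl i) j) (u x (Sum.inr i) j) (Icc 0 1) x := by
  have hc : ContinuousOn (fun t => u t (Sum.inr i) j) (Icc 0 1) :=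
    Matrix.continuousOn_iff_entry.1 h.continuousOn _ _
  -- Extending Y' by constants beyond [0, 1] makes its primitive differentiable on both sides at the
  -- end points too; restriction gives the one-sided derivatives.
  set g := IccExtend zero_le_one ((Icc (0 : ℝ) 1).domRestrict fun t => u t (Sum.inr i) j) with hg
  have hgc : Continuous g := by
    refine Continuous.Icc_extend' ?_
    exact continuousOn_iff_continuous_domRestrict.1 hc
  have hgx : ∀ t ∈ Icc (0 : ℝ) 1, g t = u t (Sum.inr i) j := fun t ht => by
    rw [hg, IccExtend_of_mem _ _ ht]; rfl
  have h1 : HasDerivAt (fun t => u 0 (Sum.inl i) j + ∫ s in (0 : ℝ)..t, g s) (g x) x :=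
    (intervalIntegral.integral_hasDerivAt_right (hgc.intervalIntegrable _ _)
      (hgc.stronglyMeasurableAtFilter _ _) hgc.continuousAt).const_add _
  rw [← hgx x hx]
  have key : ∀ t ∈ Icc (0 : ℝ) 1, u t (Sum.inl i) j = u 0 (Sum.inl i) j + ∫ s in (0 : ℝ)..t, g s := by
    intro t ht
    have h0 := left_mem_Icc.2 (zero_le_one (α := ℝ))
    have hi := h.intervalIntegrable_mul (intervalIntegrable_slMatrix hQ w z) h0 ht
    rw [h.eq t ht, Matrix.add_apply, Matrix.intervalIntegral_entry hi]
    congr 1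
    refine intervalIntegral.integral_congr fun s hs => ?_
    have hs1 := uIcc_subset_Icc h0 ht hs
    change (slMatrix Q w z s * u s) (Sum.inl i) j = g s
    rw [hgx s hs1, ← Matrix.fromRows_toRows (u s), slMatrix_mul_fromRows]
    rfl
  exact h1.hasDerivWithinAt.congr key (key x hx)

theorem SolvesLinearODE.matDeriv_toRows {u : ℝ → Matrix (Fin 2 ⊕ Fin 2) n ℂ}
    (hQ : IntervalIntegrable Q volume 0 1) (h : SolvesLinearODE (slMatrix Q w z) 1 u) {x : ℝ}
    (hx : x ∈ Icc (0 : ℝ) 1) : matDeriv (fun t => (u t).toRows₁) x = (u x).toRows₂ := by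
  ext i j
  exact (h.matDeriv_eq hQ i j hx).derivWithin (uniqueDiffOn_Icc zero_lt_one x hx)

theorem SolvesLinearODE.ae_hasDerivAt {u : ℝ → Matrix (Fin 2 ⊕ Fin 2) n ℂ}
    (hQ : IntervalIntegrable Q volume 0 1) (h : SolvesLinearODE (slMatrix Q w z) 1 u) :
    ∀ᵐ x ∂(volume.restrict (Ioo (0 : ℝ) 1)), ∀ i j, HasDerivAt (fun t => u t (Sum.inr i) j)
      (((Q x - z • Matrix.diagonal w) * (u x).toRows₁) i j) x := by
  have h0 := left_mem_Icc.2 (zero_le_one (α := ℝ))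
  have hi := h.intervalIntegrable_mul (intervalIntegrable_slMatrix hQ w z) h0
    (right_mem_Icc.2 (zero_le_one (α := ℝ)))
  rw [ae_restrict_iff' measurableSet_Ioo]
  have hall : ∀ᵐ x : ℝ, ∀ i j, x ∈ uIcc (0 : ℝ) 1 → ∀ c ∈ uIcc (0 : ℝ) 1,
      HasDerivAt (fun x => ∫ t in c..x, (slMatrix Q w z t * u t) i j)
        ((slMatrix Q w z x * u x) i j) x :=
    ae_all_iff.2 fun i => ae_all_iff.2 fun j =>
      (Matrix.intervalIntegrable_iff_entry.1 hi i j).ae_hasDerivAt_integral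
  filter_upwards [hall] with x hx hxI i j
  have h1 := (hx (Sum.inr i) j (by rw [uIcc_of_le zero_le_one]; exact Ioo_subset_Icc_self hxI) 0
    left_mem_uIcc).const_add (u 0 (Sum.inr i) j)
  have h2 : (slMatrix Q w z x * u x) (Sum.inr i) j
      = ((Q x - z • Matrix.diagonal w) * (u x).toRows₁) i j := by
    conv_lhs => rw [← Matrix.fromRows_toRows (u x), slMatrix_mul_fromRows]
    rfl
  rw [h2] at h1
  refine h1.congr_of_eventuallyEq ?_
  filter_upwards [Ioo_mem_nhds hxI.1 hxI.2] with t ht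
  have ht' := Ioo_subset_Icc_self ht
  rw [h.eq t ht', Matrix.add_apply, Matrix.intervalIntegral_entry
    (h.intervalIntegrable_mul (intervalIntegrable_slMatrix hQ w z) h0 ht')]

theorem SolvesLinearODE.isSLSolution {u : ℝ → Matrix (Fin 2 ⊕ Fin 2) n ℂ}
    (hQ : IntervalIntegrable Q volume 0 1) (h : SolvesLinearODE (slMatrix Q w z) 1 u) :
    IsSLSolution Q w z (fun x => (u x).toRows₁) := by
  have hI : uIcc (0 : ℝ) 1 = Icc 0 1 := uIcc_of_le zero_le_one
  have h0 := left_mem_Icc.2 (zero_le_one (α := ℝ))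
  have hD : ∀ x ∈ Icc (0 : ℝ) 1, ∀ i j,
      matDeriv (fun t => (u t).toRows₁) x i j = u x (Sum.inr i) j := fun x hx i j => by
    rw [h.matDeriv_toRows hQ hx]; rfl
  refine ⟨fun i j x hx => (h.matDeriv_eq hQ i j hx).differentiableWithinAt, fun i j => ?_, ?_⟩
  · have hi := Matrix.intervalIntegrable_iff_entry.1 (h.intervalIntegrable_mul
      (intervalIntegrable_slMatrix hQ w z) h0 (right_mem_Icc.2 zero_le_one)) (Sum.inr i) j
    refine hi.absolutelyContinuousOnInterval_integral.of_dist_le fun x hx y hy => ?_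
    rw [hI] at hx hy
    have key : ∀ t ∈ Icc (0 : ℝ) 1, matDeriv (fun t => (u t).toRows₁) t i j
        = u 0 (Sum.inr i) j + ∫ s in (0 : ℝ)..t, (slMatrix Q w z s * u s) (Sum.inr i) j := by
      intro t ht
      rw [hD t ht, h.eq t ht, Matrix.add_apply, Matrix.intervalIntegral_entry
        (h.intervalIntegrable_mul (intervalIntegrable_slMatrix hQ w z) h0 ht)]
    rw [key x hx, key y hy, dist_add_left]
  · have hmem := ae_restrict_mem (μ := volume) (measurableSet_Ioo (a := (0 : ℝ)) (b := 1))
    filter_upwards [h.ae_hasDerivAt hQ, hmem] with x hx hxI i j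
    have h1 : HasDerivAt (fun t => matDeriv (fun t => (u t).toRows₁) t i j)
        (((Q x - z • Matrix.diagonal w) * (u x).toRows₁) i j) x := by
      refine (hx i j).congr_of_eventuallyEq ?_
      filter_upwards [Ioo_mem_nhds hxI.1 hxI.2] with t ht
      exact hD t (Ioo_subset_Icc_self ht) i j
    refine ⟨h1.differentiableAt, ?_⟩
    rw [h1.deriv, Matrix.sub_mul, Matrix.sub_apply, Matrix.smul_mul, Matrix.smul_apply, smul_eq_mul]
    ring

end SturmLiouville

/-! ### Integrable perturbations of diagonal systems with constant exponents. -/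

section Perturbation

open scoped Matrix.Norms.L2Operator

/-- Variation of constants for a scalar equation. -/
theorem eq_exp_mul_add_integral {f h : ℝ → ℂ} {d : ℂ} {b : ℝ} (hb : 0 ≤ b)
    (hf : ContinuousOn f (Icc 0 b)) (hh : IntervalIntegrable h volume 0 b)
    (heq : ∀ x ∈ Icc 0 b, f x = f 0 + ∫ t in (0 : ℝ)..x, (d * f t + h t)) :
    f b = Complex.exp (b * d) * f 0
      + ∫ t in (0 : ℝ)..b, Complex.exp (((b - t : ℝ) : ℂ) * d) * h t := by
  have hI : uIcc 0 b = Icc 0 b := uIcc_of_le hb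
  have hg : IntervalIntegrable (fun t => d * f t + h t) volume 0 b :=
    (ContinuousOn.intervalIntegrable (by rw [hI]; exact continuousOn_const.mul hf)).add hh
  have hfac : AbsolutelyContinuousOnInterval f 0 b :=
    hg.absolutelyContinuousOnInterval_integral.of_dist_le fun x hx y hy => by
      rw [heq x (hI ▸ hx), heq y (hI ▸ hy), dist_add_left]
  -- Integrating factor: the product exp(-td) f(t) has derivative exp(-td) h(t) almost everywhere.
  have hE : ∀ t : ℝ, HasDerivAt (fun t : ℝ => Complex.exp (-(t * d)))
      (-(Complex.exp (-(t * d)) * d)) t := by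
    intro t
    have h1 : HasDerivAt (fun t : ℝ => -((t : ℂ) * d)) (-(1 * d)) t :=
      ((Complex.ofRealCLM.hasDerivAt (x := t)).mul_const d).neg
    have h2 := h1.cexp
    convert! h2 using 1
    ring
  have hEac : AbsolutelyContinuousOnInterval (fun t : ℝ => Complex.exp (-(t * d))) 0 b := by
    refine ContDiffOn.absolutelyContinuousOnInterval (ContDiff.contDiffOn ?_)
    have : ContDiff ℝ 1 fun t : ℝ => -((t : ℂ) * d) :=
      (Complex.ofRealCLM.contDiff.mul contDiff_const).neg
    exact this.cexp
  have hint : IntervalIntegrable (fun t : ℝ => Complex.exp (-(t * d)) * h t) volume 0 b :=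
    hh.continuousOn_mul hEac.continuousOn
  have key := (hEac.fun_smul hfac).integral_eq_sub_of_ae_hasDerivAt hint (by
    filter_upwards [hg.ae_hasDerivAt_integral, Measure.ae_ne volume (0 : ℝ),
      Measure.ae_ne volume b] with x hx hx0 hxb hxI
    have hxI' := hI ▸ hxI
    have h1 := (hx hxI 0 left_mem_uIcc).const_add (f 0)
    have h2 : HasDerivAt f (d * f x + h x) x := by
      refine h1.congr_of_eventuallyEq ?_
      filter_upwards [Icc_mem_nhds (lt_of_le_of_ne hxI'.1 hx0.symm)
        (lt_of_le_of_ne hxI'.2 hxb)] with t ht using heq t ht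
    have h3 := (hE x).mul h2
    simp only [smul_eq_mul]
    convert! h3 using 1
    ring)
  simp only [smul_eq_mul, Complex.ofReal_zero, zero_mul, neg_zero, Complex.exp_zero,
    one_mul] at key
  have h4 : ∀ t : ℝ, Complex.exp (((b - t : ℝ) : ℂ) * d) * h t
      = Complex.exp (b * d) * (Complex.exp (-(t * d)) * h t) := by
    intro t
    rw [← mul_assoc, ← Complex.exp_add]
    congr 2
    push_cast
    ring
  simp only [h4]
  rw [intervalIntegral.integral_const_mul, key, mul_sub, ← mul_assoc, ← Complex.exp_add]
  simp

variable {m n : Type*} [Fintype m] [DecidableEq m] [Fintype n] [DecidableEq n]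

theorem norm_diagonal_exp_le {d : m → ℂ} {σ : ℝ} (hd : ∀ i, (d i).re ≤ σ) {x : ℝ} (hx : 0 ≤ x) :
    ‖Matrix.diagonal fun i => Complex.exp (x * d i)‖ ≤ Real.exp (σ * x) := by
  rw [Matrix.l2_opNorm_diagonal, pi_norm_le_iff_of_nonneg (Real.exp_pos _).le]
  intro i
  rw [Complex.norm_exp, Complex.re_ofReal_mul, Real.exp_le_exp, mul_comm σ]
  exact mul_le_mul_of_nonneg_left (hd i) hx

namespace SolvesLinearODE

variable {d : m → ℂ} {q : ℝ → Matrix m m ℂ} {u : ℝ → Matrix m n ℂ} {b σ : ℝ}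

theorem eq_diagonal_exp_mul_add_integral
    (h : SolvesLinearODE (fun t => Matrix.diagonal d + q t) b u)
    (hq : IntervalIntegrable q volume 0 b) (hb : 0 ≤ b) :
    u b = (Matrix.diagonal fun i => Complex.exp (b * d i)) * u 0
      + ∫ t in (0 : ℝ)..b,
        (Matrix.diagonal fun i => Complex.exp (((b - t : ℝ) : ℂ) * d i)) * (q t * u t) := by
  have hI : uIcc 0 b = Icc 0 b := uIcc_of_le hb
  have hqu : IntervalIntegrable (fun t => q t * u t) volume 0 b :=
    Matrix.intervalIntegrable_mul hq (hI ▸ h.continuousOn)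
  have hA : IntervalIntegrable (fun t => Matrix.diagonal d + q t) volume 0 b :=
    intervalIntegrable_const.add hq
  have hexp : ∀ i, Continuous fun t : ℝ => Complex.exp (((b - t : ℝ) : ℂ) * d i) := fun i => by
    fun_prop
  have hint : IntervalIntegrable (fun t => (Matrix.diagonal fun i =>
      Complex.exp (((b - t : ℝ) : ℂ) * d i)) * (q t * u t)) volume 0 b := by
    rw [Matrix.intervalIntegrable_iff_entry] at hqu ⊢
    intro i j
    simp only [Matrix.diagonal_mul]
    exact (hqu i j).continuousOn_mul (hexp i).continuousOn
  ext i j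
  rw [Matrix.add_apply, Matrix.diagonal_mul, Matrix.intervalIntegral_entry hint]
  simp only [Matrix.diagonal_mul]
  refine eq_exp_mul_add_integral hb (Matrix.continuousOn_iff_entry.1 h.continuousOn i j)
    (Matrix.intervalIntegrable_iff_entry.1 hqu i j) fun x hx => ?_
  have hi := h.intervalIntegrable_mul hA (left_mem_Icc.2 hb) hx
  rw [h.eq x hx, Matrix.add_apply, Matrix.intervalIntegral_entry hi]
  simp only [Matrix.add_mul, Matrix.add_apply, Matrix.diagonal_mul]

/-- Once exp(σx) is factored out of the variation of constants formula, Grönwall sees only ∫ ‖q‖.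
The error is thus measured against the fastest admissible growth, not against each exponent
separately. -/
theorem norm_sub_diagonal_exp_mul_le
    (h : SolvesLinearODE (fun t => Matrix.diagonal d + q t) b u)
    (hq : IntervalIntegrable q volume 0 b) (hb : 0 ≤ b) (hd : ∀ i, (d i).re ≤ σ) :
    ‖u b - (Matrix.diagonal fun i => Complex.exp (b * d i)) * u 0‖
      ≤ Real.exp (σ * b) * ((∫ t in (0 : ℝ)..b, ‖q t‖)
        * Real.exp (∫ t in (0 : ℝ)..b, ‖q t‖)) * ‖u 0‖ := by
  have hsub : ∀ x ∈ Icc 0 b, uIcc 0 x ⊆ uIcc 0 b := fun x hx => by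
    rw [uIcc_of_le hb]; exact uIcc_subset_Icc (left_mem_Icc.2 hb) hx
  have hmono : ∀ x ∈ Icc 0 b, IntervalIntegrable q volume 0 x := fun x hx =>
    hq.mono_set (hsub x hx)
  have hnu : ContinuousOn (fun t => ‖u t‖) (uIcc 0 b) := by
    rw [uIcc_of_le hb]; exact h.continuousOn.norm
  have hexp : Continuous fun t : ℝ => Real.exp (-(σ * t)) := by fun_prop
  have hint : ∀ x ∈ Icc 0 b,
      ‖∫ t in (0 : ℝ)..x, (Matrix.diagonal fun i => Complex.exp (((x - t : ℝ) : ℂ) * d i))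
        * (q t * u t)‖
      ≤ Real.exp (σ * x) * ∫ t in (0 : ℝ)..x, ‖q t‖ * (Real.exp (-(σ * t)) * ‖u t‖) := by
    intro x hx
    rw [← intervalIntegral.integral_const_mul]
    refine intervalIntegral.norm_integral_le_of_norm_le hx.1
      (Filter.Eventually.of_forall fun t ht => ?_) ?_
    · refine (Matrix.l2_opNorm_mul _ _).trans ?_
      calc _ ≤ Real.exp (σ * (x - t)) * (‖q t‖ * ‖u t‖) := by
            gcongr
            · exact norm_diagonal_exp_le hd (sub_nonneg.2 ht.2)
            · exact Matrix.l2_opNorm_mul _ _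
        _ = _ := by
            rw [mul_sub, sub_eq_add_neg, Real.exp_add]; ring
    · exact ((hmono x hx).norm.mul_continuousOn
        (hexp.continuousOn.mul (hnu.mono (hsub x hx)))).const_mul _
  have hform : ∀ x ∈ Icc 0 b, _ := fun x hx =>
    (h.mono hx.2).eq_diagonal_exp_mul_add_integral (hmono x hx) hx.1
  have hgron : ∀ x ∈ Icc 0 b, Real.exp (-(σ * x)) * ‖u x‖
      ≤ ‖u 0‖ * Real.exp (∫ t in (0 : ℝ)..b, ‖q t‖) := by
    intro y hy
    have h1 : Real.exp (-(σ * y)) * ‖u y‖ ≤ ‖u 0‖ * Real.exp (∫ t in (0 : ℝ)..y, ‖q t‖) := by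
      refine le_mul_exp_of_le_add_integral (u := fun x => Real.exp (-(σ * x)) * ‖u x‖) hy.1
        ((hexp.continuousOn.mul hnu).mono ?_) (hmono y hy).norm
        (fun _ => norm_nonneg _) fun x hx => ?_
      · rw [uIcc_of_le hb]; exact Icc_subset_Icc_right hy.2
      · have hx' : x ∈ Icc 0 b := ⟨hx.1, hx.2.trans hy.2⟩
        have h2 : ‖u x‖ ≤ Real.exp (σ * x) * (‖u 0‖
            + ∫ t in (0 : ℝ)..x, ‖q t‖ * (Real.exp (-(σ * t)) * ‖u t‖)) := by
          rw [hform x hx', mul_add]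
          refine (norm_add_le _ _).trans (add_le_add ?_ (hint x hx'))
          exact (Matrix.l2_opNorm_mul _ _).trans
            (mul_le_mul_of_nonneg_right (norm_diagonal_exp_le hd hx.1) (norm_nonneg _))
        rw [Real.exp_neg, inv_mul_le_iff₀ (Real.exp_pos _)]
        exact h2
    refine h1.trans ?_
    gcongr
    exact intervalIntegral.integral_mono_interval le_rfl hy.1 hy.2
      (Filter.Eventually.of_forall fun _ => norm_nonneg _) hq.norm
  have hbb := right_mem_Icc.2 hb
  conv_lhs => rw [hform b hbb, add_sub_cancel_left]
  refine (hint b hbb).trans ?_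
  rw [mul_assoc]
  refine mul_le_mul_of_nonneg_left ?_ (Real.exp_pos _).le
  calc _ ≤ ∫ t in (0 : ℝ)..b, ‖q t‖ * (‖u 0‖ * Real.exp (∫ t in (0 : ℝ)..b, ‖q t‖)) := by
        refine intervalIntegral.integral_mono_on hb
          (hq.norm.mul_continuousOn (hexp.continuousOn.mul hnu)) (hq.norm.mul_const _)
          fun t ht => ?_
        exact mul_le_mul_of_nonneg_left (hgron t ht) (norm_nonneg _)
    _ = _ := by rw [intervalIntegral.integral_mul_const]; ring

end SolvesLinearODE

end Perturbation

/-! ### Entire functions of order 1/2 with limits on two rays. -/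

section PhragmenLindelof

open Filter Topology

/-- The substitution z = exp ζ turns the sector into a strip of width b - a. Taking r = exp(|Re ζ| /
2) in the growth bound gives growth exp(B exp(|Re ζ| / 2)), admissible for Phragmén–Lindelöf exactly
when 1/2 < π / (b - a). -/
theorem norm_le_on_sector_of_order_half {f : ℂ → ℂ} (hf : Differentiable ℂ f) {B C K a b : ℝ}
    (hgrowth : ∀ r : ℝ, 1 ≤ r → ∀ z : ℂ, ‖z‖ ≤ r ^ 2 → ‖f z‖ ≤ C * Real.exp (B * r))
    (hab : a < b) (hab2 : b - a < 2 * Real.pi)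
    (ha : ∀ ζ : ℂ, ζ.im = a → ‖f (Complex.exp ζ)‖ ≤ K)
    (hb : ∀ ζ : ℂ, ζ.im = b → ‖f (Complex.exp ζ)‖ ≤ K) {ζ : ℂ} (h1 : a ≤ ζ.im) (h2 : ζ.im ≤ b) :
    ‖f (Complex.exp ζ)‖ ≤ K := by
  refine PhragmenLindelof.horizontal_strip (f := fun ζ => f (Complex.exp ζ))
    (hf.comp Complex.differentiable_exp).diffContOnCl ⟨1 / 2, ?_, B, ?_⟩ ha hb h1 h2
  · rw [lt_div_iff₀ (by linarith)]; linarith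
  · refine Asymptotics.isBigO_of_le' (c := C) _ fun ζ => ?_
    have hr : 1 ≤ Real.exp (1 / 2 * |ζ.re|) := Real.one_le_exp (by positivity)
    refine (hgrowth _ hr _ ?_).trans (by rw [Real.norm_of_nonneg (Real.exp_pos _).le])
    rw [Complex.norm_exp, ← Real.exp_nat_mul, Real.exp_le_exp]
    push_cast
    linarith [le_abs_self ζ.re]

theorem exp_eq_of_im_eq_arg {μ ζ : ℂ} (hμ : μ ≠ 0) (h : ζ.im = Complex.arg μ) :
    Complex.exp ζ = ((Real.exp ζ.re / ‖μ‖ : ℝ) : ℂ) * μ := by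
  have h1 : ζ = ζ.re + Complex.arg μ * Complex.I := by rw [← h, Complex.re_add_im]
  have h2 := Complex.norm_mul_exp_arg_mul_I μ
  have h3 : (‖μ‖ : ℂ) ≠ 0 := by simpa using hμ
  generalize ‖μ‖ = r at h2 h3 ⊢
  generalize Complex.arg μ = θ at h1 h2
  conv_lhs => rw [h1, Complex.exp_add]
  rw [← h2]
  push_cast
  field_simp

theorem exists_bound_on_ray {f : ℂ → ℂ} (hf : Continuous f) {μ L : ℂ}
    (hlim : Tendsto (fun s : ℝ => f ((s ^ 2 : ℝ) * μ)) atTop (𝓝 L)) :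
    ∃ K, ∀ t : ℝ, 0 ≤ t → ‖f (t * μ)‖ ≤ K := by
  have hev := hlim.norm.eventually (gt_mem_nhds (lt_add_one ‖L‖))
  obtain ⟨S, hS⟩ := eventually_atTop.1 hev
  have hc : Continuous fun s : ℝ => f ((s ^ 2 : ℝ) * μ) := by fun_prop
  obtain ⟨K, hK⟩ := (isCompact_Icc (a := (0 : ℝ)) (b := S)).exists_bound_of_continuousOn
    hc.continuousOn
  refine ⟨max K (‖L‖ + 1), fun t ht => ?_⟩
  rw [← Real.sq_sqrt ht]
  rcases le_total S (Real.sqrt t) with h | h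
  · exact (hS _ h).le.trans (le_max_right _ _)
  · exact (hK _ ⟨Real.sqrt_nonneg t, h⟩).trans (le_max_left _ _)

/-- An entire function of order at most `1 / 2` and finite type that tends to `L` along two
distinct rays is constant. -/
theorem eq_of_tendsto_on_two_rays {f : ℂ → ℂ} (hf : Differentiable ℂ f) {B C : ℝ}
    (hgrowth : ∀ r : ℝ, 1 ≤ r → ∀ z : ℂ, ‖z‖ ≤ r ^ 2 → ‖f z‖ ≤ C * Real.exp (B * r)) {μ ν L : ℂ}
    (hμ : μ ≠ 0) (hν : ν ≠ 0) (hμν : Complex.arg μ ≠ Complex.arg ν)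
    (hlimμ : Tendsto (fun s : ℝ => f ((s ^ 2 : ℝ) * μ)) atTop (𝓝 L))
    (hlimν : Tendsto (fun s : ℝ => f ((s ^ 2 : ℝ) * ν)) atTop (𝓝 L)) (z : ℂ) : f z = L := by
  wlog hlt : Complex.arg μ < Complex.arg ν generalizing μ ν
  · exact this hν hμ hμν.symm hlimν hlimμ (lt_of_le_of_ne (not_lt.1 hlt) hμν.symm)
  obtain ⟨K₁, hK₁⟩ := exists_bound_on_ray hf.continuous hlimμ
  obtain ⟨K₂, hK₂⟩ := exists_bound_on_ray hf.continuous hlimν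
  set K := max K₁ K₂
  have hμK : ∀ ζ : ℂ, ζ.im = Complex.arg μ → ‖f (Complex.exp ζ)‖ ≤ K := fun ζ hζ => by
    rw [exp_eq_of_im_eq_arg hμ hζ]
    exact (hK₁ _ (by positivity)).trans (le_max_left _ _)
  have hνK : ∀ ζ : ℂ, ζ.im = Complex.arg ν → ‖f (Complex.exp ζ)‖ ≤ K := fun ζ hζ => by
    rw [exp_eq_of_im_eq_arg hν hζ]
    exact (hK₂ _ (by positivity)).trans (le_max_right _ _)
  -- The ray of μ, met again after a full turn, closes the second sector, from arg ν to arg μ + 2π.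
  -- Its opening is below 2π because arg μ < arg ν, and together the two sectors cover the plane.
  have hμK' : ∀ ζ : ℂ, ζ.im = Complex.arg μ + 2 * Real.pi → ‖f (Complex.exp ζ)‖ ≤ K :=
    fun ζ hζ => by
      have := hμK (ζ - 2 * Real.pi * Complex.I) (by simp [hζ])
      rwa [Complex.exp_periodic.sub_eq] at this
  have hμ1 := Complex.neg_pi_lt_arg μ
  have hν1 := Complex.arg_le_pi ν
  have hbound : ∀ z, ‖f z‖ ≤ K := by
    intro z
    rcases eq_or_ne z 0 with rfl | hz
    · have := (hK₁ 0 le_rfl).trans (le_max_left K₁ K₂)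
      rwa [Complex.ofReal_zero, zero_mul] at this
    rcases lt_or_ge (Complex.arg z) (Complex.arg μ) with h | h
    · have h2 : Complex.exp (Complex.log z + 2 * Real.pi * Complex.I) = z := by
        rw [Complex.exp_periodic, Complex.exp_log hz]
      have h3 : (Complex.log z + 2 * Real.pi * Complex.I).im = Complex.arg z + 2 * Real.pi := by
        simp [Complex.log_im]
      have h4 := Complex.neg_pi_lt_arg z
      rw [← h2]
      exact norm_le_on_sector_of_order_half hf hgrowth (a := Complex.arg ν)
        (b := Complex.arg μ + 2 * Real.pi) (by linarith) (by linarith) hνK hμK'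
        (by rw [h3]; linarith) (by rw [h3]; linarith)
    · rw [← Complex.exp_log hz]
      rcases le_total (Complex.arg z) (Complex.arg ν) with h' | h'
      · exact norm_le_on_sector_of_order_half hf hgrowth hlt (by linarith) hμK hνK
          (by rwa [Complex.log_im]) (by rwa [Complex.log_im])
      · exact norm_le_on_sector_of_order_half hf hgrowth (a := Complex.arg ν)
          (b := Complex.arg μ + 2 * Real.pi) (by linarith) (by linarith) hνK hμK'
          (by rwa [Complex.log_im]) (by rw [Complex.log_im]; linarith [Complex.arg_le_pi z])
  have hconst : ∀ z w, f z = f w := fun z w =>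
    hf.apply_eq_apply_of_bounded
      (isBounded_iff_forall_norm_le.2 ⟨K, by rintro _ ⟨z, rfl⟩; exact hbound z⟩) z w
  have : Tendsto (fun s : ℝ => f ((s ^ 2 : ℝ) * μ)) atTop (𝓝 (f z)) := by
    simp only [hconst _ z]; exact tendsto_const_nhds
  exact tendsto_nhds_unique this hlimμ

end PhragmenLindelof

/-! ### Rays on which the exponents have equal real parts. -/

section Rays

theorem exists_real_mul_of_im_mul_re_eq {a b : ℂ} (hb : b ≠ 0) (h : a.im * b.re = a.re * b.im) :
    ∃ c : ℝ, a = c * b := by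
  have hn : b.re * b.re + b.im * b.im ≠ 0 := (Complex.normSq_pos.2 hb).ne'
  refine ⟨(a.re * b.re + a.im * b.im) / (b.re * b.re + b.im * b.im), ?_⟩
  apply Complex.ext
  · rw [Complex.re_ofReal_mul]
    rw [div_mul_eq_mul_div, eq_div_iff hn]
    linear_combination -b.im * h
  · rw [Complex.im_ofReal_mul]
    rw [div_mul_eq_mul_div, eq_div_iff hn]
    linear_combination b.re * h

theorem exists_real_mul_of_arg_sq_eq {p q : ℂ} (hp : p ≠ 0) (hq : q ≠ 0)
    (h : Complex.arg (p ^ 2) = Complex.arg (q ^ 2)) : ∃ c : ℝ, q = c * p := by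
  rw [Complex.arg_eq_arg_iff (pow_ne_zero 2 hp) (pow_ne_zero 2 hq), norm_pow, norm_pow] at h
  have h' : (((‖q‖ / ‖p‖ : ℝ) : ℂ) * p) ^ 2 = q ^ 2 := by
    rw [← h]; push_cast; ring
  rcases sq_eq_sq_iff_eq_or_eq_neg.1 h' with h1 | h1
  · exact ⟨_, h1.symm⟩
  · exact ⟨-(‖q‖ / ‖p‖), by rw [Complex.ofReal_neg, neg_mul, h1, neg_neg]⟩

/-- The two rays on which the exponents of both components of the unperturbed equation have equal
positive real parts. -/
theorem exists_two_rays {w : Fin 2 → ℂ} (hw : w 0 * w 1 ≠ 0)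
    (harg : Complex.arg (w 0) ≠ Complex.arg (w 1)) :
    ∃ μ ν : ℂ, μ ≠ 0 ∧ ν ≠ 0 ∧ Complex.arg μ ≠ Complex.arg ν ∧
      (∃ κ : Fin 2 → ℂ, ∀ i, κ i ^ 2 = -(μ * w i) ∧ (κ i).re = 1) ∧
      ∃ κ : Fin 2 → ℂ, ∀ i, κ i ^ 2 = -(ν * w i) ∧ (κ i).re = 1 := by
  obtain ⟨σ, hσ⟩ : ∃ σ : Fin 2 → ℂ, ∀ i, σ i ^ 2 = -w i :=
    ⟨_, fun i => (IsAlgClosed.exists_pow_nat_eq (-w i) two_pos).choose_spec⟩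
  have hw0 : w 0 ≠ 0 := left_ne_zero_of_mul hw
  have hw1 : w 1 ≠ 0 := right_ne_zero_of_mul hw
  have hσ1 : σ 1 ≠ 0 := fun h => hw1 (by have := hσ 1; rw [h] at this; simpa using this.symm)
  -- J is the determinant of the real linear system prescribing Re(pσ₀) and Re(pσ₁). If it vanished,
  -- σ₀ would be a real multiple of σ₁ and w₀, w₁ would have the same argument.
  set J : ℝ := (σ 0).im * (σ 1).re - (σ 0).re * (σ 1).im with hJdef
  have hJ : J ≠ 0 := by
    intro h0
    obtain ⟨c, hc⟩ := exists_real_mul_of_im_mul_re_eq hσ1 (sub_eq_zero.1 h0)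
    have h1 : w 0 = ((c ^ 2 : ℝ) : ℂ) * w 1 := by
      have e0 := hσ 0
      have e1 := hσ 1
      rw [hc] at e0
      push_cast
      linear_combination e0 - (c : ℂ) ^ 2 * e1
    have hc0 : 0 < c ^ 2 := by
      refine sq_pos_of_ne_zero fun h => hw0 ?_
      rw [h1, h]; simp
    exact harg (by rw [h1, Complex.arg_real_mul _ hc0])
  -- Cramer's rule: p has Re(pσ₀) = Re(pσ₁) = 1, while q has Re(qσ₀) = -1 and Re(qσ₁) = 1.
  set p : ℂ := ((J⁻¹ : ℝ) : ℂ) * ⟨(σ 0).im - (σ 1).im, (σ 0).re - (σ 1).re⟩ with hp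
  set q : ℂ := ((J⁻¹ : ℝ) : ℂ) * ⟨(σ 0).im + (σ 1).im, (σ 0).re + (σ 1).re⟩ with hq
  have hJ' : ((J⁻¹ : ℝ) : ℂ) ≠ 0 := by simpa using hJ
  have hp0 : p ≠ 0 := by
    refine mul_ne_zero hJ' fun h => hJ ?_
    have h1 := congrArg Complex.re h
    have h2 := congrArg Complex.im h
    simp only [Complex.zero_re, Complex.zero_im, sub_eq_zero] at h1 h2
    rw [hJdef, h1, h2]; ring
  have hq0 : q ≠ 0 := by
    refine mul_ne_zero hJ' fun h => hJ ?_
    have h1 := congrArg Complex.re h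
    have h2 := congrArg Complex.im h
    simp only [Complex.zero_re, Complex.zero_im] at h1 h2
    rw [hJdef, eq_neg_of_add_eq_zero_left h1, eq_neg_of_add_eq_zero_left h2]; ring
  have hpσ : ∀ i, (p * σ i).re = 1 := by
    intro i
    rw [hp, mul_assoc, Complex.re_ofReal_mul, Complex.mul_re, inv_mul_eq_one₀ hJ]
    fin_cases i <;> simp only [hJdef, Fin.zero_eta, Fin.mk_one] <;> ring
  have hqσ : (q * σ 0).re = -1 ∧ (q * σ 1).re = 1 := by
    constructor <;> rw [hq, mul_assoc, Complex.re_ofReal_mul, Complex.mul_re]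
    · rw [← neg_inj, neg_neg, ← mul_neg, inv_mul_eq_one₀ hJ, hJdef]; ring
    · rw [inv_mul_eq_one₀ hJ, hJdef]; ring
  -- Only the squares of the exponents are prescribed, so on the second ray the sign of qσ₀ may be
  -- flipped to make its real part 1. The rays differ since p and q are not real multiples of each
  -- other.
  refine ⟨p ^ 2, q ^ 2, pow_ne_zero 2 hp0, pow_ne_zero 2 hq0, fun h => hJ ?_,
    ⟨fun i => p * σ i, fun i => ⟨by rw [mul_pow, hσ]; ring, hpσ i⟩⟩,
    ⟨![-(q * σ 0), q * σ 1], fun i => ?_⟩⟩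
  · obtain ⟨c, hc⟩ := exists_real_mul_of_arg_sq_eq hp0 hq0 h
    rw [hp, hq, mul_left_comm] at hc
    have h1 := mul_left_cancel₀ hJ' hc
    have h2 := congrArg Complex.re h1
    have h3 := congrArg Complex.im h1
    simp only [Complex.re_ofReal_mul, Complex.im_ofReal_mul] at h2 h3
    rw [hJdef]
    linear_combination (((σ 0).re - (σ 1).re) * h2 - ((σ 0).im - (σ 1).im) * h3) / (-2)
  · fin_cases i
    · exact ⟨by simp only [Fin.zero_eta, Matrix.cons_val_zero]; rw [neg_sq, mul_pow, hσ]; ring,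
        by simp [-Complex.mul_re, hqσ.1]⟩
    · exact ⟨by change (q * σ 1) ^ 2 = -(q ^ 2 * w 1); rw [mul_pow, hσ]; ring,
        by simpa [-Complex.mul_re] using hqσ.2⟩

end Rays

/-! ### The Weyl matrix expressed by boundary data at the right end point. -/

section WeylSolution

open scoped Matrix.Norms.L2Operator

variable {Q : ℝ → Matrix (Fin 2) (Fin 2) ℂ} {w : Fin 2 → ℂ} {z : ℂ}
  {T : Matrix (Fin 2) (Fin 2) ℂ} {Ψ : ℝ → Matrix (Fin 2 ⊕ Fin 2) (Fin 2 ⊕ Fin 2) ℂ}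

/-- Cauchy data at the right end point that span the kernel of the boundary form. -/
noncomputable def boundaryData (T : Matrix (Fin 2) (Fin 2) ℂ) (s : ℂ) :
    Matrix (Fin 2 ⊕ Fin 2) (Fin 2) ℂ :=
  Matrix.fromRows (s⁻¹ • T) (-(1 - T))

/-- Applying T separates the two parts of the boundary form, so T B = 0 and T A = A. Hence A is
recovered from the T-part of s A - B and B from its T^⊥-part. -/
theorem fromRows_eq_boundaryData_mul {n : Type} (hT : T * T = T) {s : ℂ} (hs : s ≠ 0)
    {A B : Matrix (Fin 2) n ℂ} (h : T * B - (1 - T) * A = 0) :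
    Matrix.fromRows A B = boundaryData T s * (s • A - B) := by
  have h1 : T * B = 0 := by
    have := congrArg (T * ·) h
    simp only [Matrix.mul_sub, Matrix.mul_zero, ← Matrix.mul_assoc, hT, Matrix.mul_one,
      sub_self, Matrix.zero_mul, sub_zero] at this
    exact this
  have h2 : T * A = A := by
    rw [h1, zero_sub, neg_eq_zero, Matrix.sub_mul, Matrix.one_mul, sub_eq_zero] at h
    exact h.symm
  rw [boundaryData, Matrix.fromRows_mul]
  congr 1
  · rw [Matrix.smul_mul, Matrix.mul_sub, h1, sub_zero, Matrix.mul_smul, h2, smul_smul,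
      inv_mul_cancel₀ hs, one_smul]
  · rw [Matrix.neg_mul, Matrix.sub_mul, Matrix.one_mul, Matrix.mul_sub, h1, sub_zero,
      Matrix.mul_smul, h2]
    abel

theorem IsSLSolution.fromRows_eq {n : Type} [Fintype n] [DecidableEq n]
    (hQ : IntervalIntegrable Q volume 0 1) (hΨ : SolvesLinearODE (slMatrix Q w z) 1 Ψ)
    (hΨ0 : Ψ 0 = 1) (hT : T * T = T) {s : ℂ} (hs : s ≠ 0) {Y : ℝ → Matrix (Fin 2) n ℂ}
    (hY : IsSLSolution Q w z Y) (hb : boundaryForm T Y = 0) {x : ℝ} (hx : x ∈ Icc (0 : ℝ) 1) :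
    Matrix.fromRows (Y x) (matDeriv Y x)
      = Ψ x * ((Ψ 1)⁻¹ * boundaryData T s) * (s • Y 1 - matDeriv Y 1) := by
  have hA := intervalIntegrable_slMatrix hQ w z
  have h1 := fun {x} (hx : x ∈ Icc (0 : ℝ) 1) => hΨ.eq_mul hA hΨ0 (hY.solves hQ) hx
  have hu := (Matrix.isUnit_iff_isUnit_det _).1 (hΨ.isUnit hA hΨ0 zero_le_one)
  have h2 := h1 (right_mem_Icc.2 zero_le_one)
  rw [fromRows_eq_boundaryData_mul hT hs hb] at h2
  rw [h1 hx, Matrix.mul_assoc, Matrix.mul_assoc (Ψ 1)⁻¹, h2, Matrix.nonsing_inv_mul_cancel_left _ _ hu]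

/-- The columns of Ψ(1)⁻¹ `boundaryData` are Cauchy data at 0 spanning the solutions that satisfy
the right boundary condition; normalizing their upper block to I gives the Weyl solution. Its
derivative at 0 must be shown unique, because `weylMatrix` is defined by choice. -/
theorem not_isSLEigenvalue_and_weylMatrix_eq (hQ : IntervalIntegrable Q volume 0 1)
    (hΨ : SolvesLinearODE (slMatrix Q w z) 1 Ψ) (hΨ0 : Ψ 0 = 1) (hT : T * T = T) {s : ℂ}
    (hs : s ≠ 0) (hR : IsUnit ((Ψ 1)⁻¹ * boundaryData T s).toRows₁) :
    ¬ IsSLEigenvalue Q w T z ∧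
      Matrix.fromRows 1 (weylMatrix Q w T z) = (Ψ 1)⁻¹ * boundaryData T s *
        (((Ψ 1)⁻¹ * boundaryData T s).toRows₁)⁻¹ := by
  set R := (Ψ 1)⁻¹ * boundaryData T s with hRdef
  have hA := intervalIntegrable_slMatrix hQ w z
  have hRd := (Matrix.isUnit_iff_isUnit_det _).1 hR
  have hu := (Matrix.isUnit_iff_isUnit_det _).1 (hΨ.isUnit hA hΨ0 zero_le_one)
  have h0 := left_mem_Icc.2 (zero_le_one (α := ℝ))
  have h1 := right_mem_Icc.2 (zero_le_one (α := ℝ))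
  have hRR : R = Matrix.fromRows R.toRows₁ R.toRows₂ := (Matrix.fromRows_toRows R).symm
  constructor
  · rintro ⟨Y, hY, hY0, hb, x, hx, hne⟩
    have h2 := hY.fromRows_eq hQ hΨ hΨ0 hT hs hb h0
    rw [hΨ0, Matrix.one_mul, ← hRdef, hY0, hRR, Matrix.fromRows_mul] at h2
    have h3 := (Matrix.fromRows_inj h2).1
    have h4 : s • Y 1 - matDeriv Y 1 = 0 := by
      rw [← Matrix.nonsing_inv_mul_cancel_left R.toRows₁ (s • Y 1 - matDeriv Y 1) hRd, ← h3,
        Matrix.mul_zero]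
    have h5 := hY.fromRows_eq hQ hΨ hΨ0 hT hs hb hx
    rw [h4, Matrix.mul_zero] at h5
    refine hne ?_
    ext i j
    exact congrFun (congrFun h5 (Sum.inl i)) j
  · have huniq : ∀ Φ, IsWeylSolution Q w T z Φ →
        Matrix.fromRows 1 (matDeriv Φ 0) = R * R.toRows₁⁻¹ := by
      intro Φ hΦ
      have h2 := hΦ.solution.fromRows_eq hQ hΨ hΨ0 hT hs hΦ.boundary h0
      rw [hΨ0, Matrix.one_mul, ← hRdef, hΦ.initial] at h2
      rw [h2]
      rw [hRR, Matrix.fromRows_mul] at h2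
      have h3 := (Matrix.fromRows_inj h2).1
      rw [Matrix.inv_eq_right_inv h3.symm]
    have hex : ∃ Φ, IsWeylSolution Q w T z Φ := by
      have hsol := hΨ.mul_right hA (R * R.toRows₁⁻¹)
      refine ⟨_, hsol.isSLSolution hQ, ?_, ?_⟩
      · simp only [hΨ0, Matrix.one_mul]
        conv_lhs => rw [hRR, Matrix.fromRows_mul, Matrix.toRows₁_fromRows]
        rw [Matrix.toRows₁_fromRows]
        exact Matrix.mul_nonsing_inv _ hRd
      · rw [boundaryForm, hsol.matDeriv_toRows hQ h1]
        have h2 : Ψ 1 * (R * R.toRows₁⁻¹) = boundaryData T s * R.toRows₁⁻¹ := by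
          rw [hRdef, Matrix.mul_assoc (Ψ 1)⁻¹, Matrix.mul_nonsing_inv_cancel_left _ _ hu]
        simp only [h2]
        rw [boundaryData, Matrix.fromRows_mul, Matrix.toRows₁_fromRows, Matrix.toRows₂_fromRows]
        simp only [← Matrix.mul_assoc]
        rw [← Matrix.sub_mul]
        have h3 : T * -(1 - T) - (1 - T) * s⁻¹ • T = 0 := by
          rw [Matrix.mul_neg, Matrix.mul_sub, Matrix.mul_one, hT, Matrix.mul_smul, Matrix.sub_mul,
            Matrix.one_mul, hT]
          simp
        rw [h3, Matrix.zero_mul]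
    rw [weylMatrix, dif_pos hex]
    exact huniq _ hex.choose_spec

end WeylSolution

/-! ### Diagonalization of the system on a ray. -/

section RayAsymptotics

open scoped Matrix.Norms.L2Operator
open Filter Topology

theorem Matrix.tendsto_mul_zero_of_bounded_left {l m n : Type*} [Fintype l] [Fintype m] [Fintype n]
    [DecidableEq l] [DecidableEq m] [DecidableEq n] {L : Filter ℝ} {f : ℝ → Matrix l m ℂ}
    {g : ℝ → Matrix m n ℂ} {C : ℝ} (hf : ∀ᶠ s in L, ‖f s‖ ≤ C) (hg : Tendsto g L (𝓝 0)) :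
    Tendsto (fun s => f s * g s) L (𝓝 0) := by
  refine squeeze_zero_norm' ?_ (by simpa using hg.norm.const_mul C)
  filter_upwards [hf] with s hs
  exact (Matrix.l2_opNorm_mul _ _).trans (mul_le_mul_of_nonneg_right hs (norm_nonneg _))

theorem Matrix.tendsto_mul_zero_of_bounded_right {l m n : Type*} [Fintype l] [Fintype m]
    [Fintype n] [DecidableEq l] [DecidableEq m] [DecidableEq n] {L : Filter ℝ}
    {f : ℝ → Matrix l m ℂ} {g : ℝ → Matrix m n ℂ} {C : ℝ} (hf : Tendsto f L (𝓝 0))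
    (hg : ∀ᶠ s in L, ‖g s‖ ≤ C) : Tendsto (fun s => f s * g s) L (𝓝 0) := by
  refine squeeze_zero_norm' ?_ (by simpa using hf.norm.mul_const C)
  filter_upwards [hg] with s hs
  exact (Matrix.l2_opNorm_mul _ _).trans (mul_le_mul_of_nonneg_left hs (norm_nonneg _))

theorem eventually_norm_le_of_tendsto {E : Type*} [NormedAddCommGroup E] {L : Filter ℝ} {f : ℝ → E}
    {a : E} (h : Tendsto f L (𝓝 a)) : ∀ᶠ s in L, ‖f s‖ ≤ ‖a‖ + 1 :=
  (h.norm.eventually (gt_mem_nhds (lt_add_one ‖a‖))).mono fun _ hs => hs.le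

theorem Matrix.tendsto_fromRows {m₁ m₂ n : Type*} {L : Filter ℝ} {f : ℝ → Matrix m₁ n ℂ}
    {g : ℝ → Matrix m₂ n ℂ} {a : Matrix m₁ n ℂ} {b : Matrix m₂ n ℂ} (hf : Tendsto f L (𝓝 a))
    (hg : Tendsto g L (𝓝 b)) :
    Tendsto (fun s => Matrix.fromRows (f s) (g s)) L (𝓝 (Matrix.fromRows a b)) := by
  refine tendsto_pi_nhds.2 fun i => ?_
  rcases i with i | i
  exacts [tendsto_pi_nhds.1 hf i, tendsto_pi_nhds.1 hg i]

theorem Matrix.tendsto_fromCols {m n₁ n₂ : Type*} {L : Filter ℝ} {f : ℝ → Matrix m n₁ ℂ}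
    {g : ℝ → Matrix m n₂ ℂ} {a : Matrix m n₁ ℂ} {b : Matrix m n₂ ℂ} (hf : Tendsto f L (𝓝 a))
    (hg : Tendsto g L (𝓝 b)) :
    Tendsto (fun s => Matrix.fromCols (f s) (g s)) L (𝓝 (Matrix.fromCols a b)) := by
  refine tendsto_pi_nhds.2 fun i => tendsto_pi_nhds.2 fun j => ?_
  rcases j with j | j
  exacts [tendsto_pi_nhds.1 (tendsto_pi_nhds.1 hf i) j, tendsto_pi_nhds.1 (tendsto_pi_nhds.1 hg i) j]

/-- The diagonal matrix `exp (c K)`, `K = diag κ`. -/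
noncomputable def expDiag (κ : Fin 2 → ℂ) (c : ℝ) : Matrix (Fin 2) (Fin 2) ℂ :=
  Matrix.diagonal fun i => Complex.exp (c * κ i)

theorem expDiag_mul (κ : Fin 2 → ℂ) (a b : ℝ) :
    expDiag κ a * expDiag κ b = expDiag κ (a + b) := by
  rw [expDiag, expDiag, Matrix.diagonal_mul_diagonal]
  simp only [← Complex.exp_add, ← add_mul, expDiag, Complex.ofReal_add]

theorem expDiag_zero (κ : Fin 2 → ℂ) : expDiag κ 0 = 1 := by
  simp [expDiag, ← Matrix.diagonal_one]

theorem norm_expDiag_le {κ : Fin 2 → ℂ} (hκ : ∀ i, (κ i).re = 1) (c : ℝ) :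
    ‖expDiag κ c‖ ≤ Real.exp c := by
  rw [expDiag, Matrix.l2_opNorm_diagonal, pi_norm_le_iff_of_nonneg (Real.exp_pos _).le]
  intro i
  rw [Complex.norm_exp, Complex.re_ofReal_mul, hκ, mul_one]

/-- The unitary matrix `exp (c (K - 1))`. -/
noncomputable def expDiagUnit (κ : Fin 2 → ℂ) (c : ℝ) : Matrix (Fin 2) (Fin 2) ℂ :=
  (Real.exp (-c) : ℂ) • expDiag κ c

theorem norm_expDiagUnit_le {κ : Fin 2 → ℂ} (hκ : ∀ i, (κ i).re = 1) (c : ℝ) :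
    ‖expDiagUnit κ c‖ ≤ 1 := by
  rw [expDiagUnit, norm_smul, Complex.norm_real, Real.norm_of_nonneg (Real.exp_pos _).le]
  calc _ ≤ Real.exp (-c) * Real.exp c :=
        mul_le_mul_of_nonneg_left (norm_expDiag_le hκ c) (Real.exp_pos _).le
    _ = 1 := by rw [← Real.exp_add]; simp

theorem expDiagUnit_mul (κ : Fin 2 → ℂ) (a b : ℝ) :
    expDiagUnit κ a * expDiagUnit κ b = expDiagUnit κ (a + b) := by
  rw [expDiagUnit, expDiagUnit, Matrix.smul_mul, Matrix.mul_smul, expDiag_mul, smul_smul,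
    expDiagUnit, ← Complex.ofReal_mul, ← Real.exp_add]
  congr 3
  ring

theorem expDiagUnit_zero (κ : Fin 2 → ℂ) : expDiagUnit κ 0 = 1 := by
  simp [expDiagUnit, expDiag_zero]

/-- The passage from `(Y, Y')` to `(Y' + s K Y, Y' - s K Y)`. -/
noncomputable def splitMatrix (κ : Fin 2 → ℂ) (s : ℝ) : Matrix (Fin 2 ⊕ Fin 2) (Fin 2 ⊕ Fin 2) ℂ :=
  Matrix.fromBlocks (Matrix.diagonal fun i => s * κ i) 1 (-Matrix.diagonal fun i => s * κ i) 1

/-- The inverse of `splitMatrix`. -/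
noncomputable def splitMatrixInv (κ : Fin 2 → ℂ) (s : ℝ) :
    Matrix (Fin 2 ⊕ Fin 2) (Fin 2 ⊕ Fin 2) ℂ :=
  Matrix.fromBlocks (Matrix.diagonal fun i => (2 * s * κ i)⁻¹)
    (-Matrix.diagonal fun i => (2 * s * κ i)⁻¹) ((2⁻¹ : ℂ) • 1) ((2⁻¹ : ℂ) • 1)

/-- The perturbation in the diagonalized system. -/
noncomputable def splitPotential (Q : ℝ → Matrix (Fin 2) (Fin 2) ℂ) (κ : Fin 2 → ℂ) (t : ℝ) :
    Matrix (Fin 2 ⊕ Fin 2) (Fin 2 ⊕ Fin 2) ℂ :=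
  Matrix.fromBlocks (Q t * Matrix.diagonal fun i => (2 * κ i)⁻¹)
    (-(Q t * Matrix.diagonal fun i => (2 * κ i)⁻¹)) (Q t * Matrix.diagonal fun i => (2 * κ i)⁻¹)
    (-(Q t * Matrix.diagonal fun i => (2 * κ i)⁻¹))

/-- The exponents of the diagonalized system. -/
def splitExponent (κ : Fin 2 → ℂ) (s : ℝ) : Fin 2 ⊕ Fin 2 → ℂ :=
  Sum.elim (fun i => s * κ i) fun i => -(s * κ i)

section Algebra

variable {κ : Fin 2 → ℂ} {s : ℝ}

theorem ne_zero_of_re_eq_one (hκ : ∀ i, (κ i).re = 1) (i : Fin 2) : κ i ≠ 0 := fun h => by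
  have := hκ i
  rw [h] at this
  simp at this

theorem splitMatrixInv_mul_splitMatrix (hκ : ∀ i, κ i ≠ 0) (hs : s ≠ 0) :
    splitMatrixInv κ s * splitMatrix κ s = 1 := by
  have hs' : (s : ℂ) ≠ 0 := by exact_mod_cast hs
  rw [splitMatrix, splitMatrixInv, Matrix.fromBlocks_multiply, ← Matrix.fromBlocks_one]
  congr 1
  · rw [neg_mul_neg, Matrix.diagonal_mul_diagonal, ← Matrix.diagonal_one,
      Matrix.diagonal_add]
    congr 1
    funext i
    have := hκ i
    field_simp
    norm_num
  · simp
  · rw [Matrix.smul_mul, Matrix.smul_mul, Matrix.one_mul, Matrix.one_mul, smul_neg, add_neg_cancel]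
  · rw [Matrix.mul_one, ← add_smul]
    norm_num

theorem splitMatrix_mul_splitMatrixInv (hκ : ∀ i, κ i ≠ 0) (hs : s ≠ 0) :
    splitMatrix κ s * splitMatrixInv κ s = 1 :=
  mul_eq_one_comm.1 (splitMatrixInv_mul_splitMatrix hκ hs)

/-- With κ² = -μw the terms of order s² cancel and leave the exponents ±sκ. Recovering Y from the
split variables divides by 2sκ, which is the source of the factor s⁻¹ in front of Q. -/
theorem splitMatrix_mul_slMatrix_mul (hκ : ∀ i, κ i ≠ 0) (hs : s ≠ 0) {w : Fin 2 → ℂ} {μ : ℂ}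
    (hμ : ∀ i, κ i ^ 2 = -(μ * w i)) (Q : ℝ → Matrix (Fin 2) (Fin 2) ℂ) (t : ℝ) :
    splitMatrix κ s * slMatrix Q w ((s ^ 2 : ℝ) * μ) t * splitMatrixInv κ s
      = Matrix.diagonal (splitExponent κ s) + (s⁻¹ : ℂ) • splitPotential Q κ t := by
  have hs' : (s : ℂ) ≠ 0 := by exact_mod_cast hs
  have hd : Matrix.diagonal (splitExponent κ s) = Matrix.fromBlocks
      (Matrix.diagonal fun i => (s : ℂ) * κ i) 0 0 (Matrix.diagonal fun i => -((s : ℂ) * κ i)) := by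
    rw [Matrix.fromBlocks_diagonal]; rfl
  rw [hd, splitMatrix, splitMatrixInv, slMatrix, splitPotential, Matrix.fromBlocks_multiply,
    Matrix.fromBlocks_multiply, Matrix.fromBlocks_smul, Matrix.fromBlocks_add]
  congr 1 <;> ext i j <;> have hi := hκ i <;> have hj := hκ j <;> have hw := hμ j <;>
    rcases eq_or_ne i j with rfl | hij <;>
    simp [*] <;> field_simp <;>
    first | ring1 | linear_combination (s : ℂ) ^ 2 * hw | linear_combination -(s : ℂ) ^ 2 * hw

end Algebra

end RayAsymptotics

/-! ### Asymptotics of the fundamental matrix on a ray. -/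

section RayLimits

open scoped Matrix.Norms.L2Operator
open Filter Topology

variable {Q : ℝ → Matrix (Fin 2) (Fin 2) ℂ} {w : Fin 2 → ℂ} {T : Matrix (Fin 2) (Fin 2) ℂ}
  {Ψ : ℂ → ℝ → Matrix (Fin 2 ⊕ Fin 2) (Fin 2 ⊕ Fin 2) ℂ} {κ : Fin 2 → ℂ} {μ : ℂ} {x s : ℝ}

theorem diagonal_exp_splitExponent (κ : Fin 2 → ℂ) (s x : ℝ) :
    (Matrix.diagonal fun i => Complex.exp (x * splitExponent κ s i))
      = Matrix.fromBlocks (expDiag κ (s * x)) 0 0 (expDiag κ (-(s * x))) := by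
  rw [expDiag, expDiag, Matrix.fromBlocks_diagonal]
  congr 1
  funext i
  rcases i with i | i <;> simp only [splitExponent, Sum.elim_inl, Sum.elim_inr] <;> congr 1 <;>
    push_cast <;> ring

theorem splitExponent_re_le (hκ : ∀ i, (κ i).re = 1) (hs : 0 ≤ s) (i : Fin 2 ⊕ Fin 2) :
    (splitExponent κ s i).re ≤ s ∧ (-splitExponent κ s i).re ≤ s := by
  rcases i with i | i <;> simp [splitExponent, hκ] <;> linarith

theorem intervalIntegrable_splitPotential (hQ : IntervalIntegrable Q volume 0 1) (κ : Fin 2 → ℂ) :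
    IntervalIntegrable (splitPotential Q κ) volume 0 1 := by
  have h : IntervalIntegrable (fun t => Q t * Matrix.diagonal fun i => (2 * κ i)⁻¹) volume 0 1 :=
    Matrix.intervalIntegrable_mul hQ continuousOn_const
  exact Matrix.intervalIntegrable_fromBlocks h h.neg h h.neg

/-- The fundamental solution after the change of variables. -/
theorem solves_splitMatrix_mul (hQ : IntervalIntegrable Q volume 0 1)
    (hκ : ∀ i, κ i ≠ 0) (hs : s ≠ 0) (hμ : ∀ i, κ i ^ 2 = -(μ * w i))
    {u : ℝ → Matrix (Fin 2 ⊕ Fin 2) (Fin 2 ⊕ Fin 2) ℂ}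
    (hu : SolvesLinearODE (slMatrix Q w ((s ^ 2 : ℝ) * μ)) 1 u) :
    SolvesLinearODE (fun t => Matrix.diagonal (splitExponent κ s)
      + (s⁻¹ : ℂ) • splitPotential Q κ t) 1 (fun t => splitMatrix κ s * u t) := by
  have := hu.conj (intervalIntegrable_slMatrix hQ w _) (splitMatrixInv_mul_splitMatrix hκ hs)
  simpa only [splitMatrix_mul_slMatrix_mul hκ hs hμ Q] using this

/-- The relative size of the perturbation. -/
noncomputable def splitError (Q : ℝ → Matrix (Fin 2) (Fin 2) ℂ) (κ : Fin 2 → ℂ) (s : ℝ) : ℝ :=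
  (s⁻¹ * ∫ t in (0 : ℝ)..1, ‖splitPotential Q κ t‖)
    * Real.exp (s⁻¹ * ∫ t in (0 : ℝ)..1, ‖splitPotential Q κ t‖)

theorem tendsto_splitError (Q : ℝ → Matrix (Fin 2) (Fin 2) ℂ) (κ : Fin 2 → ℂ) :
    Tendsto (splitError Q κ) atTop (𝓝 0) := by
  have h : Tendsto (fun s : ℝ => s⁻¹ * ∫ t in (0 : ℝ)..1, ‖splitPotential Q κ t‖) atTop (𝓝 0) := by
    simpa using tendsto_inv_atTop_zero.mul_const (∫ t in (0 : ℝ)..1, ‖splitPotential Q κ t‖)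
  have h2 := h.mul ((Real.continuous_exp.tendsto 0).comp h)
  rw [zero_mul] at h2
  exact h2

/-- An `L₁` perturbation of a diagonal system whose size is `1 / s`. -/
theorem SolvesLinearODE.norm_sub_le_splitError {ι : Type*} [Fintype ι] [DecidableEq ι]
    {d : ι → ℂ} {q : ℝ → Matrix ι ι ℂ} {u : ℝ → Matrix ι ι ℂ} [Nonempty ι]
    (hu : SolvesLinearODE (fun t => Matrix.diagonal d + (s⁻¹ : ℂ) • q t) 1 u) (hu0 : u 0 = 1)
    (hq : IntervalIntegrable q volume 0 1) (hs : 0 < s) (hd : ∀ i, (d i).re ≤ s)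
    (hx : x ∈ Icc (0 : ℝ) 1) {I : ℝ} (hI : ∫ t in (0 : ℝ)..1, ‖q t‖ = I) :
    ‖u x - Matrix.diagonal fun i => Complex.exp (x * d i)‖
      ≤ Real.exp (s * x) * (s⁻¹ * I * Real.exp (s⁻¹ * I)) := by
  have hq1 : IntervalIntegrable (fun t => (s⁻¹ : ℂ) • q t) volume 0 1 := hq.smul (s⁻¹ : ℂ)
  have hqx : IntervalIntegrable (fun t => (s⁻¹ : ℂ) • q t) volume 0 x := hq1.mono_set (by
    rw [uIcc_of_le zero_le_one]; exact uIcc_subset_Icc (left_mem_Icc.2 zero_le_one) hx)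
  have h := (hu.mono hx.2).norm_sub_diagonal_exp_mul_le hqx hx.1 hd
  rw [hu0, Matrix.mul_one, norm_one, mul_one] at h
  have hle : ∫ t in (0 : ℝ)..x, ‖(s⁻¹ : ℂ) • q t‖ ≤ s⁻¹ * I := by
    rw [← hI, ← intervalIntegral.integral_const_mul]
    refine (intervalIntegral.integral_mono_interval le_rfl hx.1 hx.2
      (Filter.Eventually.of_forall fun _ => norm_nonneg _) hq1.norm).trans_eq ?_
    congr 1
    funext t
    rw [norm_smul, norm_inv, Complex.norm_real, Real.norm_of_nonneg hs.le]
  have h0 : 0 ≤ ∫ t in (0 : ℝ)..x, ‖(s⁻¹ : ℂ) • q t‖ :=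
    intervalIntegral.integral_nonneg hx.1 fun _ _ => norm_nonneg _
  have h0' := h0.trans hle
  refine h.trans ?_
  gcongr

/-- Integration from the left end controls solutions only up to o(e^(sx)), which suits the growing
ones; the decaying block is lost in the error. -/
theorem tendsto_smul_split_sub (hQ : IntervalIntegrable Q volume 0 1) (hκ : ∀ i, (κ i).re = 1)
    (hμ : ∀ i, κ i ^ 2 = -(μ * w i)) (hΨ : ∀ z, SolvesLinearODE (slMatrix Q w z) 1 (Ψ z))
    (hΨ0 : ∀ z, Ψ z 0 = 1) (hx : x ∈ Icc (0 : ℝ) 1) :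
    Tendsto (fun s : ℝ => (Real.exp (-(s * x)) : ℂ) •
      (splitMatrix κ s * Ψ ((s ^ 2 : ℝ) * μ) x * splitMatrixInv κ s
        - Matrix.fromBlocks (expDiag κ (s * x)) 0 0 (expDiag κ (-(s * x))))) atTop (𝓝 0) := by
  refine squeeze_zero_norm' ?_ (tendsto_splitError Q κ)
  filter_upwards [eventually_gt_atTop 0] with s hs
  have hκ0 := ne_zero_of_re_eq_one hκ
  have hq := intervalIntegrable_splitPotential hQ κ
  have hsol := (solves_splitMatrix_mul hQ hκ0 hs.ne' hμ (hΨ ((s ^ 2 : ℝ) * μ))).mul_right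
    (intervalIntegrable_const.add (hq.smul (s⁻¹ : ℂ))) (splitMatrixInv κ s)
  have h := hsol.norm_sub_le_splitError (by
    rw [hΨ0, Matrix.mul_one, splitMatrix_mul_splitMatrixInv hκ0 hs.ne']) hq hs
    (fun i => (splitExponent_re_le hκ hs.le i).1) hx rfl
  rw [diagonal_exp_splitExponent] at h
  rw [norm_smul, Complex.norm_real, Real.norm_of_nonneg (Real.exp_pos _).le, Real.exp_neg,
    inv_mul_le_iff₀ (Real.exp_pos _)]
  exact h

/-- Counterpart for decaying solutions: integrating backwards from 1 swaps growth and decay, and the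
same estimate applies since the negated exponents also have real part at most s. -/
theorem tendsto_smul_split_inv_sub (hQ : IntervalIntegrable Q volume 0 1)
    (hκ : ∀ i, (κ i).re = 1) (hμ : ∀ i, κ i ^ 2 = -(μ * w i))
    (hΨ : ∀ z, SolvesLinearODE (slMatrix Q w z) 1 (Ψ z)) (hΨ0 : ∀ z, Ψ z 0 = 1)
    (hx : x ∈ Icc (0 : ℝ) 1) :
    Tendsto (fun s : ℝ => (Real.exp (-(s * (1 - x))) : ℂ) •
      (splitMatrix κ s * Ψ ((s ^ 2 : ℝ) * μ) x * (Ψ ((s ^ 2 : ℝ) * μ) 1)⁻¹ * splitMatrixInv κ s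
        - Matrix.fromBlocks (expDiag κ (-(s * (1 - x)))) 0 0 (expDiag κ (s * (1 - x)))))
      atTop (𝓝 0) := by
  refine squeeze_zero_norm' ?_ (tendsto_splitError Q κ)
  filter_upwards [eventually_gt_atTop 0] with s hs
  have hκ0 := ne_zero_of_re_eq_one hκ
  have hq := intervalIntegrable_splitPotential hQ κ
  have hA : IntervalIntegrable (fun t => Matrix.diagonal (splitExponent κ s)
      + (s⁻¹ : ℂ) • splitPotential Q κ t) volume 0 1 := intervalIntegrable_const.add (hq.smul (s⁻¹ : ℂ))
  have hu := (Matrix.isUnit_iff_isUnit_det _).1 ((hΨ ((s ^ 2 : ℝ) * μ)).isUnit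
    (intervalIntegrable_slMatrix hQ w _) (hΨ0 _) zero_le_one)
  have hsol := ((solves_splitMatrix_mul hQ hκ0 hs.ne' hμ (hΨ ((s ^ 2 : ℝ) * μ))).mul_right hA
    ((Ψ ((s ^ 2 : ℝ) * μ) 1)⁻¹ * splitMatrixInv κ s)).reflect hA
  have hsol' : SolvesLinearODE (fun t => Matrix.diagonal (-splitExponent κ s)
      + (s⁻¹ : ℂ) • (-splitPotential Q κ (1 - t))) 1 (fun t => splitMatrix κ s *
        Ψ ((s ^ 2 : ℝ) * μ) (1 - t) * ((Ψ ((s ^ 2 : ℝ) * μ) 1)⁻¹ * splitMatrixInv κ s)) := by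
    convert hsol using 2
    rw [smul_neg, neg_add, Matrix.diagonal_neg]
    rfl
  have hx' : 1 - x ∈ Icc (0 : ℝ) 1 := ⟨sub_nonneg.2 hx.2, by linarith [hx.1]⟩
  have h := hsol'.norm_sub_le_splitError (by
    rw [sub_zero, Matrix.mul_assoc, Matrix.mul_nonsing_inv_cancel_left _ _ hu,
      splitMatrix_mul_splitMatrixInv hκ0 hs.ne']) (SolvesLinearODE.intervalIntegrable_reflect hq) hs
    (fun i => (splitExponent_re_le hκ hs.le i).2) hx' (I := ∫ t in (0 : ℝ)..1,
      ‖splitPotential Q κ t‖) (by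
      simp only [norm_neg]
      rw [intervalIntegral.integral_comp_sub_left (fun t => ‖splitPotential Q κ t‖) 1]
      simp)
  have hd : (Matrix.diagonal fun i => Complex.exp ((1 - x : ℝ) * (-splitExponent κ s) i))
      = Matrix.fromBlocks (expDiag κ (-(s * (1 - x)))) 0 0 (expDiag κ (s * (1 - x))) := by
    have := diagonal_exp_splitExponent κ s (-(1 - x))
    rw [mul_neg, neg_neg] at this
    rw [← this]
    congr 1
    funext i
    rw [Pi.neg_apply, Complex.ofReal_neg, mul_neg, neg_mul]
  rw [hd, sub_sub_cancel, ← Matrix.mul_assoc] at h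
  rw [norm_smul, Complex.norm_real, Real.norm_of_nonneg (Real.exp_pos _).le, Real.exp_neg,
    inv_mul_le_iff₀ (Real.exp_pos _)]
  exact h

end RayLimits

/-! ### Asymptotics of S and of the Weyl solution on a ray. -/

section RayWeyl

open scoped Matrix.Norms.L2Operator
open Filter Topology

variable {Q : ℝ → Matrix (Fin 2) (Fin 2) ℂ} {w : Fin 2 → ℂ} {T : Matrix (Fin 2) (Fin 2) ℂ}
  {Ψ : ℂ → ℝ → Matrix (Fin 2 ⊕ Fin 2) (Fin 2 ⊕ Fin 2) ℂ} {κ : Fin 2 → ℂ} {μ : ℂ} {x s : ℝ}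

/-- If the numerical range of `K = diag κ` lies in the open right half plane, then
`K T + T^⊥` is invertible for every orthogonal projector `T`. -/
theorem isUnit_diagonal_mul_add (hκ : ∀ i, 0 < (κ i).re) (hT : Tᴴ = T) (hT2 : T * T = T) :
    IsUnit (Matrix.diagonal κ * T + (1 - T)) := by
  rw [Matrix.isUnit_iff_isUnit_det, isUnit_iff_ne_zero]
  intro hdet
  obtain ⟨v, hv, hv0⟩ := Matrix.exists_mulVec_eq_zero_iff.2 hdet
  refine hv ?_
  set y := T *ᵥ v with hy
  -- Pairing with y = Tv removes the orthogonal term T^⊥v. The real part of what remains is Σ Re κ_i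
  -- |y_i|², a definite form, so y = 0 and then v = T^⊥v = 0.
  have h1 : star y ⬝ᵥ (Matrix.diagonal κ *ᵥ y) = 0 := by
    have h2 := congrArg (star y ⬝ᵥ ·) hv0
    simp only [Matrix.add_mulVec, ← Matrix.mulVec_mulVec, dotProduct_add, dotProduct_zero] at h2
    have h3 : star y ⬝ᵥ ((1 - T) *ᵥ v) = 0 := by
      rw [hy, Matrix.star_mulVec, ← Matrix.dotProduct_mulVec, Matrix.mulVec_mulVec, hT,
        Matrix.mul_sub, Matrix.mul_one, hT2, sub_self, Matrix.zero_mulVec, dotProduct_zero]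
    rwa [h3, add_zero] at h2
  have h4 : ∑ i, (κ i).re * Complex.normSq (y i) = 0 := by
    have h5 := congrArg Complex.re h1
    simp only [dotProduct, Matrix.mulVec_diagonal, Complex.re_sum, Complex.zero_re] at h5
    rw [← h5]
    refine Finset.sum_congr rfl fun i _ => ?_
    simp only [Pi.star_apply, Complex.star_def, Complex.mul_re, Complex.mul_im, Complex.conj_re,
      Complex.conj_im, Complex.normSq_apply]
    ring
  have hy0 : y = 0 := by
    funext i
    have h6 := (Finset.sum_eq_zero_iff_of_nonneg fun i _ =>
      mul_nonneg (hκ i).le (Complex.normSq_nonneg (y i))).1 h4 i (Finset.mem_univ i)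
    exact Complex.normSq_eq_zero.1 ((mul_eq_zero.1 h6).resolve_left (hκ i).ne')
  rw [Matrix.add_mulVec, ← Matrix.mulVec_mulVec, ← hy, hy0, Matrix.mulVec_zero, zero_add,
    Matrix.sub_mulVec, Matrix.one_mulVec, ← hy, hy0, sub_zero] at hv0
  exact hv0

/-- The boundary data at the right end point in the split variables. -/
theorem splitMatrix_mul_boundaryData (hs : s ≠ 0) :
    splitMatrix κ s * boundaryData T s
      = Matrix.fromRows (Matrix.diagonal κ * T - (1 - T)) (-(Matrix.diagonal κ * T + (1 - T))) := by
  have hs' : (s : ℂ) ≠ 0 := by exact_mod_cast hs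
  -- The factor s⁻¹ in `boundaryData` is chosen for this cancellation: in split variables the
  -- boundary data do not depend on s.
  have hd : (Matrix.diagonal fun i => (s : ℂ) * κ i) * (s : ℂ)⁻¹ • T = Matrix.diagonal κ * T := by
    ext i j
    simp only [Matrix.diagonal_mul, Matrix.smul_apply, smul_eq_mul]
    field_simp
  rw [splitMatrix, boundaryData, Matrix.fromBlocks_mul_fromRows, Matrix.neg_mul, hd,
    Matrix.one_mul]
  congr 1
  abel

/-- The difference of the two split variables recovers `Y`. -/
theorem fromCols_mul_splitMatrix :
    (Matrix.fromCols (-1) 1 : Matrix (Fin 2) (Fin 2 ⊕ Fin 2) ℂ) * splitMatrix κ s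
      = Matrix.fromCols (Matrix.diagonal fun i => -(2 * s * κ i)) 0 := by
  rw [splitMatrix, Matrix.fromCols_mul_fromBlocks]
  congr 1
  · rw [Matrix.one_mul, Matrix.neg_mul, Matrix.one_mul, Matrix.diagonal_neg, Matrix.diagonal_add]
    congr 1; funext i; ring
  · simp

theorem exp_neg_smul_expDiag (κ : Fin 2 → ℂ) (c : ℝ) :
    (Real.exp (-c) : ℂ) • expDiag κ c = expDiagUnit κ c := rfl

theorem tendsto_exp_neg_smul_expDiag_neg (hκ : ∀ i, (κ i).re = 1) {c : ℝ} (hc : 0 < c) :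
    Tendsto (fun s : ℝ => (Real.exp (-(s * c)) : ℂ) • expDiag κ (-(s * c))) atTop (𝓝 0) := by
  have h : Tendsto (fun s : ℝ => Real.exp (-(s * c))) atTop (𝓝 0) :=
    Real.tendsto_exp_neg_atTop_nhds_zero.comp (tendsto_id.atTop_mul_const hc)
  refine squeeze_zero_norm' (Filter.Eventually.of_forall fun s => ?_) (by simpa using h.mul h)
  rw [norm_smul, Complex.norm_real, Real.norm_of_nonneg (Real.exp_pos _).le]
  exact mul_le_mul_of_nonneg_left (norm_expDiag_le hκ _) (Real.exp_pos _).le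

/-- The columns of the matrix solution `S` with `S(0) = 0`, `S'(0) = 1`. -/
theorem tendsto_growing_columns (hQ : IntervalIntegrable Q volume 0 1) (hκ : ∀ i, (κ i).re = 1)
    (hμ : ∀ i, κ i ^ 2 = -(μ * w i)) (hΨ : ∀ z, SolvesLinearODE (slMatrix Q w z) 1 (Ψ z))
    (hΨ0 : ∀ z, Ψ z 0 = 1) (hx : x ∈ Ioo (0 : ℝ) 1) :
    Tendsto (fun s : ℝ => (splitMatrix κ s * Ψ ((s ^ 2 : ℝ) * μ) x) *
        (Matrix.fromRows 0 ((Real.exp (-(s * x)) : ℂ) • 1) : Matrix (Fin 2 ⊕ Fin 2) (Fin 2) ℂ)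
      - Matrix.fromRows (expDiagUnit κ (s * x)) 0) atTop (𝓝 0) := by
  have h1 := tendsto_smul_split_sub hQ hκ hμ hΨ hΨ0 (Ioo_subset_Icc_self hx)
  have h2 := Matrix.tendsto_mul_zero_of_bounded_right (n := Fin 2) h1
    (g := fun _ => (Matrix.fromRows 1 1 : Matrix (Fin 2 ⊕ Fin 2) (Fin 2) ℂ)) (Filter.Eventually.of_forall fun _ => le_rfl)
  have h3 := Matrix.tendsto_fromRows (tendsto_const_nhds (x := (0 : Matrix (Fin 2) (Fin 2) ℂ)))
    (tendsto_exp_neg_smul_expDiag_neg hκ hx.1)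
  have h4 := h2.add h3
  rw [Matrix.fromRows_zero, add_zero] at h4
  refine h4.congr' ?_
  filter_upwards [eventually_gt_atTop 0] with s hs
  have hκ0 := ne_zero_of_re_eq_one hκ
  -- The initial data (0, I) of S become (I, I) in split variables; the second component decays and
  -- disappears in the limit because x > 0.
  have hinv : splitMatrixInv κ s *
      (Matrix.fromRows 1 1 : Matrix (Fin 2 ⊕ Fin 2) (Fin 2) ℂ)
      = Matrix.fromRows 0 (1 : Matrix (Fin 2) (Fin 2) ℂ) := by
    rw [splitMatrixInv, Matrix.fromBlocks_mul_fromRows]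
    congr 1
    · simp
    · rw [Matrix.mul_one, ← add_smul]; norm_num
  have hsm : Matrix.fromRows (0 : Matrix (Fin 2) (Fin 2) ℂ)
      ((Real.exp (-(s * x)) : ℂ) • (1 : Matrix (Fin 2) (Fin 2) ℂ))
      = (Real.exp (-(s * x)) : ℂ) • Matrix.fromRows 0 1 := by
    ext (i | i) j <;> simp
  rw [hsm, Matrix.mul_smul, ← hinv, ← Matrix.mul_assoc, Matrix.smul_mul, Matrix.sub_mul, smul_sub,
    Matrix.fromBlocks_mul_fromRows]
  have hfr : ∀ (c : ℂ) (A B : Matrix (Fin 2) (Fin 2) ℂ),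
      c • Matrix.fromRows A B = Matrix.fromRows (c • A) (c • B) := fun c A B => by
    ext (i | i) j <;> rfl
  simp only [hfr, Matrix.mul_one, add_zero, zero_add]
  rw [exp_neg_smul_expDiag, sub_add]
  congr 1
  ext (i | i) j <;> simp

/-- The solutions with prescribed boundary data at the right end point. -/
theorem tendsto_smul_split_boundaryData (hQ : IntervalIntegrable Q volume 0 1)
    (hκ : ∀ i, (κ i).re = 1) (hμ : ∀ i, κ i ^ 2 = -(μ * w i))
    (hΨ : ∀ z, SolvesLinearODE (slMatrix Q w z) 1 (Ψ z)) (hΨ0 : ∀ z, Ψ z 0 = 1)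
    (hx : x ∈ Ico (0 : ℝ) 1) :
    Tendsto (fun s : ℝ => (Real.exp (-(s * (1 - x))) : ℂ) • (splitMatrix κ s *
        (Ψ ((s ^ 2 : ℝ) * μ) x * ((Ψ ((s ^ 2 : ℝ) * μ) 1)⁻¹ * boundaryData T s)))
      - Matrix.fromRows 0 (expDiagUnit κ (s * (1 - x)) * -(Matrix.diagonal κ * T + (1 - T))))
      atTop (𝓝 0) := by
  set p := Matrix.diagonal κ * T - (1 - T) with hp
  set q := -(Matrix.diagonal κ * T + (1 - T)) with hq
  have h1 := tendsto_smul_split_inv_sub hQ hκ hμ hΨ hΨ0 (Ico_subset_Icc_self hx)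
  have h2 := Matrix.tendsto_mul_zero_of_bounded_right (n := Fin 2) h1
    (g := fun _ => Matrix.fromRows p q) (Filter.Eventually.of_forall fun _ => le_rfl)
  have h3 := Matrix.tendsto_fromRows (Matrix.tendsto_mul_zero_of_bounded_right
    (tendsto_exp_neg_smul_expDiag_neg hκ (sub_pos.2 hx.2)) (g := fun _ => p)
    (Filter.Eventually.of_forall fun _ => le_rfl))
    (tendsto_const_nhds (x := (0 : Matrix (Fin 2) (Fin 2) ℂ)))
  have h4 := h2.add h3
  rw [Matrix.fromRows_zero, add_zero] at h4
  refine h4.congr' ?_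
  filter_upwards [eventually_gt_atTop 0] with s hs
  have hG := splitMatrixInv_mul_splitMatrix (ne_zero_of_re_eq_one hκ) hs.ne'
  have hC := splitMatrix_mul_boundaryData (κ := κ) (T := T) hs.ne'
  have hE : ∀ A B : Matrix (Fin 2 ⊕ Fin 2) (Fin 2 ⊕ Fin 2) ℂ,
      splitMatrix κ s * A * B * splitMatrixInv κ s * Matrix.fromRows p q
        = splitMatrix κ s * (A * (B * boundaryData T s)) := fun A B => by
    rw [hp, hq, ← hC]
    simp only [Matrix.mul_assoc]
    rw [← Matrix.mul_assoc (splitMatrixInv κ s), hG, Matrix.one_mul]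
  have hfr : ∀ (c : ℂ) (A B : Matrix (Fin 2) (Fin 2) ℂ),
      c • Matrix.fromRows A B = Matrix.fromRows (c • A) (c • B) := fun c A B => by
    ext (i | i) j <;> rfl
  rw [Matrix.smul_mul, Matrix.sub_mul, hE, smul_sub, Matrix.fromBlocks_mul_fromRows, hfr,
    Matrix.zero_mul, Matrix.zero_mul, add_zero, zero_add, ← Matrix.smul_mul _ (expDiag κ (-_)),
    ← Matrix.smul_mul _ (expDiag κ (s * (1 - x))), exp_neg_smul_expDiag κ (s * (1 - x)), sub_add]
  congr 1
  ext (i | i) j <;> simp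

/-- The normalized initial values of the solutions with boundary data at the right end point. -/
noncomputable def initialMatrix (Ψ : ℂ → ℝ → Matrix (Fin 2 ⊕ Fin 2) (Fin 2 ⊕ Fin 2) ℂ)
    (T : Matrix (Fin 2) (Fin 2) ℂ) (κ : Fin 2 → ℂ) (μ : ℂ) (s : ℝ) : Matrix (Fin 2) (Fin 2) ℂ :=
  expDiagUnit κ (-s) * ((Real.exp (-s) : ℂ) • ((Matrix.diagonal fun i => -(2 * s * κ i)) *
    ((Ψ ((s ^ 2 : ℝ) * μ) 1)⁻¹ * boundaryData T s).toRows₁))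

theorem tendsto_initialMatrix (hQ : IntervalIntegrable Q volume 0 1)
    (hκ : ∀ i, (κ i).re = 1) (hμ : ∀ i, κ i ^ 2 = -(μ * w i))
    (hΨ : ∀ z, SolvesLinearODE (slMatrix Q w z) 1 (Ψ z)) (hΨ0 : ∀ z, Ψ z 0 = 1) :
    Tendsto (initialMatrix Ψ T κ μ) atTop (𝓝 (-(Matrix.diagonal κ * T + (1 - T)))) := by
  have h1 := tendsto_smul_split_boundaryData (T := T) hQ hκ hμ hΨ hΨ0
    (left_mem_Ico.2 (zero_lt_one (α := ℝ)))
  -- The row (-I, I) turns the split pair into -2sKY, isolating the initial value Y(0); the factor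
  -- `expDiagUnit κ (-s)` applied next cancels the oscillation of the leading term.
  have h2 := Matrix.tendsto_mul_zero_of_bounded_left (l := Fin 2)
    (f := fun _ => (Matrix.fromCols (-1) 1 : Matrix (Fin 2) (Fin 2 ⊕ Fin 2) ℂ))
    (Filter.Eventually.of_forall fun _ => le_rfl) h1
  have h3 := Matrix.tendsto_mul_zero_of_bounded_left (f := fun s : ℝ => expDiagUnit κ (-s))
    (Filter.Eventually.of_forall fun s => norm_expDiagUnit_le hκ (-s)) h2
  refine tendsto_sub_nhds_zero_iff.1 (h3.congr fun s => ?_)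
  rw [Matrix.mul_sub, Matrix.mul_smul, ← Matrix.mul_assoc, fromCols_mul_splitMatrix, hΨ0,
    Matrix.one_mul, Matrix.fromCols_mul_fromRows, Matrix.mul_zero, zero_add, Matrix.one_mul,
    Matrix.mul_sub, ← Matrix.mul_assoc (expDiagUnit κ (-s)) (expDiagUnit κ _), expDiagUnit_mul]
  have hR := Matrix.fromRows_toRows ((Ψ ((s ^ 2 : ℝ) * μ) 1)⁻¹ * boundaryData T s)
  rw [← hR, Matrix.fromCols_mul_fromRows, Matrix.zero_mul, add_zero, initialMatrix, sub_zero,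
    mul_one, neg_add_cancel, expDiagUnit_zero, Matrix.one_mul]

/-- The limit -(KT + T^⊥) is invertible and units form an open set. This is what keeps eigenvalues
away from the far part of the ray. -/
theorem eventually_isUnit_initialMatrix (hQ : IntervalIntegrable Q volume 0 1)
    (hκ : ∀ i, (κ i).re = 1) (hμ : ∀ i, κ i ^ 2 = -(μ * w i))
    (hΨ : ∀ z, SolvesLinearODE (slMatrix Q w z) 1 (Ψ z)) (hΨ0 : ∀ z, Ψ z 0 = 1)
    (hT : Tᴴ = T) (hT2 : T * T = T) : ∀ᶠ s in atTop, IsUnit (initialMatrix Ψ T κ μ s) :=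
  (tendsto_initialMatrix hQ hκ hμ hΨ hΨ0).eventually (Units.isOpen.mem_nhds
    (isUnit_diagonal_mul_add (fun i => by rw [hκ]; exact one_pos) hT hT2).neg)

theorem isUnit_toRows_of_initialMatrix (h : IsUnit (initialMatrix Ψ T κ μ s)) :
    IsUnit ((Ψ ((s ^ 2 : ℝ) * μ) 1)⁻¹ * boundaryData T s).toRows₁ := by
  rw [Matrix.isUnit_iff_isUnit_det, initialMatrix, ← Matrix.mul_smul, Matrix.det_mul,
    Matrix.det_mul, Matrix.det_smul] at h
  rw [Matrix.isUnit_iff_isUnit_det]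
  exact isUnit_of_mul_isUnit_right (isUnit_of_mul_isUnit_right (isUnit_of_mul_isUnit_right h))

/-- The normalization of the Weyl solution. -/
noncomputable def weylScale (κ : Fin 2 → ℂ) (s : ℝ) : Matrix (Fin 2) (Fin 2) ℂ :=
  Matrix.diagonal fun i => (-(2 * s * κ i))⁻¹

theorem inv_toRows_mul_weylScale (hκ : ∀ i, κ i ≠ 0) (hs : s ≠ 0)
    (h : IsUnit (initialMatrix Ψ T κ μ s)) :
    (((Ψ ((s ^ 2 : ℝ) * μ) 1)⁻¹ * boundaryData T s).toRows₁)⁻¹ * weylScale κ s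
      = (Real.exp (-s) : ℂ) • ((initialMatrix Ψ T κ μ s)⁻¹ * expDiagUnit κ (-s)) := by
  have hu := (Matrix.isUnit_iff_isUnit_det _).1 (isUnit_toRows_of_initialMatrix h)
  have hN := (Matrix.isUnit_iff_isUnit_det _).1 h
  set R := ((Ψ ((s ^ 2 : ℝ) * μ) 1)⁻¹ * boundaryData T s).toRows₁ with hR
  have hs' : (s : ℂ) ≠ 0 := by exact_mod_cast hs
  have hd : (Matrix.diagonal fun i => -(2 * s * κ i)) * weylScale κ s = 1 := by
    rw [weylScale, Matrix.diagonal_mul_diagonal, ← Matrix.diagonal_one]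
    congr 1
    funext i
    have := hκ i
    exact mul_inv_cancel₀ (neg_ne_zero.2 (mul_ne_zero (mul_ne_zero two_ne_zero hs') this))
  have h1 : initialMatrix Ψ T κ μ s * (R⁻¹ * weylScale κ s)
      = (Real.exp (-s) : ℂ) • expDiagUnit κ (-s) := by
    rw [initialMatrix, ← hR, Matrix.mul_assoc, Matrix.smul_mul, Matrix.mul_assoc,
      Matrix.mul_nonsing_inv_cancel_left _ _ hu, hd, Matrix.mul_smul, Matrix.mul_one]
  rw [← Matrix.mul_smul, ← h1, Matrix.nonsing_inv_mul_cancel_left _ _ hN]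

/-- The columns of the normalized Weyl solution. -/
theorem tendsto_decaying_columns (hQ : IntervalIntegrable Q volume 0 1)
    (hκ : ∀ i, (κ i).re = 1) (hμ : ∀ i, κ i ^ 2 = -(μ * w i))
    (hΨ : ∀ z, SolvesLinearODE (slMatrix Q w z) 1 (Ψ z)) (hΨ0 : ∀ z, Ψ z 0 = 1)
    (hT : Tᴴ = T) (hT2 : T * T = T) (hx : x ∈ Ioo (0 : ℝ) 1) :
    Tendsto (fun s : ℝ => (splitMatrix κ s * Ψ ((s ^ 2 : ℝ) * μ) x) *
        ((Real.exp (s * x) : ℂ) • ((Matrix.fromRows 1 (weylMatrix Q w T ((s ^ 2 : ℝ) * μ)) :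
          Matrix (Fin 2 ⊕ Fin 2) (Fin 2) ℂ) * weylScale κ s))
      - Matrix.fromRows 0 (expDiagUnit κ (-(s * x)))) atTop (𝓝 0) := by
  have hκ0 := ne_zero_of_re_eq_one hκ
  have hN := tendsto_initialMatrix (T := T) hQ hκ hμ hΨ hΨ0
  set q := -(Matrix.diagonal κ * T + (1 - T)) with hq
  have hqu : IsUnit q :=
    (isUnit_diagonal_mul_add (fun i => by rw [hκ]; exact one_pos) hT hT2).neg
  have hqd := (Matrix.isUnit_iff_isUnit_det _).1 hqu
  have hNi : Tendsto (fun s => (initialMatrix Ψ T κ μ s)⁻¹) atTop (𝓝 q⁻¹) := by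
    obtain ⟨v, hv⟩ := hqu
    have := (NormedRing.inverse_continuousAt v).tendsto
    rw [hv] at this
    simp only [Matrix.nonsing_inv_eq_ringInverse]
    exact this.comp hN
  have hb : ∀ᶠ s : ℝ in atTop, ‖(initialMatrix Ψ T κ μ s)⁻¹ * expDiagUnit κ (-s)‖ ≤ ‖q⁻¹‖ + 1 := by
    filter_upwards [eventually_norm_le_of_tendsto hNi] with s hs
    exact (Matrix.l2_opNorm_mul _ _).trans ((mul_le_mul hs (norm_expDiagUnit_le hκ _)
      (norm_nonneg _) (by positivity)).trans_eq (mul_one _))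
  have h1 := Matrix.tendsto_mul_zero_of_bounded_right
    (tendsto_smul_split_boundaryData (T := T) hQ hκ hμ hΨ hΨ0 (Ioo_subset_Ico_self hx)) hb
  -- The oscillating factors on either side of q N⁻¹, with N the initial matrix, have norm at most 1
  -- and need not converge, so only q N⁻¹ → 1 is required to replace their product by `expDiagUnit κ
  -- (-(s * x))`.
  have h2 : Tendsto (fun s => q * (initialMatrix Ψ T κ μ s)⁻¹ - 1) atTop (𝓝 0) := by
    have := (hNi.const_mul q).sub_const 1
    rwa [Matrix.mul_nonsing_inv _ hqd, sub_self] at this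
  have h3 := Matrix.tendsto_mul_zero_of_bounded_right (Matrix.tendsto_mul_zero_of_bounded_left
    (f := fun s : ℝ => expDiagUnit κ (s * (1 - x)))
    (Filter.Eventually.of_forall fun s => norm_expDiagUnit_le hκ _) h2)
    (g := fun s : ℝ => expDiagUnit κ (-s))
    (Filter.Eventually.of_forall fun s => norm_expDiagUnit_le hκ _)
  have h4 := h1.add (Matrix.tendsto_fromRows
    (tendsto_const_nhds (x := (0 : Matrix (Fin 2) (Fin 2) ℂ))) h3)
  rw [Matrix.fromRows_zero, add_zero] at h4
  refine h4.congr' ?_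
  filter_upwards [eventually_gt_atTop 0,
    eventually_isUnit_initialMatrix hQ hκ hμ hΨ hΨ0 hT hT2] with s hs hus
  have hs' : (s : ℂ) ≠ 0 := by exact_mod_cast hs.ne'
  -- The scale e^(sx) meets e^(-s) from the inverse initial values and leaves e^(-s(1-x)), the
  -- normalization of the solutions integrated from the right end.
  rw [(not_isSLEigenvalue_and_weylMatrix_eq hQ (hΨ _) (hΨ0 _) hT2 hs'
    (isUnit_toRows_of_initialMatrix hus)).2, Matrix.mul_assoc _ _ (weylScale κ s),
    inv_toRows_mul_weylScale hκ0 hs.ne' hus, Matrix.mul_smul,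
    Matrix.mul_smul, Matrix.mul_smul, smul_smul, ← Complex.ofReal_mul,
    ← Real.exp_add, show s * x + -s = -(s * (1 - x)) by ring, Matrix.sub_mul,
    Matrix.smul_mul]
  set N := initialMatrix Ψ T κ μ s with hNs
  have e1 : expDiagUnit κ (s * (1 - x)) * (q * N⁻¹ - 1) * expDiagUnit κ (-s)
      = expDiagUnit κ (s * (1 - x)) * q * (N⁻¹ * expDiagUnit κ (-s)) - expDiagUnit κ (-(s * x)) := by
    rw [Matrix.mul_sub, Matrix.sub_mul, Matrix.mul_one, expDiagUnit_mul,
      show s * (1 - x) + -s = -(s * x) by ring]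
    simp only [Matrix.mul_assoc]
  rw [e1, Matrix.fromRows_mul, Matrix.zero_mul, sub_add]
  congr 1
  · simp only [Matrix.mul_assoc]
  · rw [← hq]
    ext (i | i) j <;> simp

/-- The Cauchy data of `(S, Φ)`, normalized at the point `x`. -/
noncomputable def weylData (M : Matrix (Fin 2) (Fin 2) ℂ) (κ : Fin 2 → ℂ) (x s : ℝ) :
    Matrix (Fin 2 ⊕ Fin 2) (Fin 2 ⊕ Fin 2) ℂ :=
  Matrix.fromCols (Matrix.fromRows 0 ((Real.exp (-(s * x)) : ℂ) • 1))
    ((Real.exp (s * x) : ℂ) • ((Matrix.fromRows 1 M : Matrix (Fin 2 ⊕ Fin 2) (Fin 2) ℂ) * weylScale κ s))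

/-- The leading term of `(S, Φ)` in the split variables. -/
noncomputable def leadingTerm (κ : Fin 2 → ℂ) (c : ℝ) :
    Matrix (Fin 2 ⊕ Fin 2) (Fin 2 ⊕ Fin 2) ℂ :=
  Matrix.fromBlocks (expDiagUnit κ c) 0 0 (expDiagUnit κ (-c))

theorem leadingTerm_mul_leadingTerm_neg (κ : Fin 2 → ℂ) (c : ℝ) :
    leadingTerm κ c * leadingTerm κ (-c) = 1 := by
  rw [leadingTerm, leadingTerm, Matrix.fromBlocks_multiply, expDiagUnit_mul, expDiagUnit_mul,
    ← Matrix.fromBlocks_one]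
  simp [expDiagUnit_zero]

theorem norm_leadingTerm_le (hκ : ∀ i, (κ i).re = 1) (c : ℝ) : ‖leadingTerm κ c‖ ≤ 1 := by
  have h : leadingTerm κ c = Matrix.diagonal (Sum.elim
      (fun i => (Real.exp (-c) : ℂ) * Complex.exp (c * κ i))
      fun i => (Real.exp c : ℂ) * Complex.exp (-(c * κ i))) := by
    rw [leadingTerm, expDiagUnit, expDiagUnit, expDiag, expDiag, ← Matrix.diagonal_smul,
      ← Matrix.diagonal_smul, Matrix.fromBlocks_diagonal]
    congr 1
    funext i
    rcases i with i | i <;> simp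
  rw [h, Matrix.l2_opNorm_diagonal, pi_norm_le_iff_of_nonneg zero_le_one]
  rintro (i | i) <;>
    simp [Complex.norm_exp, hκ, -Complex.ofReal_exp, Real.abs_exp, ← Real.exp_add]

theorem tendsto_split_mul_weylData (hQ : IntervalIntegrable Q volume 0 1)
    (hκ : ∀ i, (κ i).re = 1) (hμ : ∀ i, κ i ^ 2 = -(μ * w i))
    (hΨ : ∀ z, SolvesLinearODE (slMatrix Q w z) 1 (Ψ z)) (hΨ0 : ∀ z, Ψ z 0 = 1)
    (hT : Tᴴ = T) (hT2 : T * T = T) (hx : x ∈ Ioo (0 : ℝ) 1) :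
    Tendsto (fun s : ℝ => splitMatrix κ s * Ψ ((s ^ 2 : ℝ) * μ) x *
        weylData (weylMatrix Q w T ((s ^ 2 : ℝ) * μ)) κ x s - leadingTerm κ (s * x))
      atTop (𝓝 0) := by
  have h := Matrix.tendsto_fromCols (tendsto_growing_columns hQ hκ hμ hΨ hΨ0 hx)
    (tendsto_decaying_columns hQ hκ hμ hΨ hΨ0 hT hT2 hx)
  rw [Matrix.fromCols_zero] at h
  refine h.congr fun s => ?_
  rw [weylData, Matrix.mul_fromCols, leadingTerm, ← Matrix.fromCols_fromRows_eq_fromBlocks]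
  ext (i | i) (j | j) <;> simp

theorem eventually_not_isSLEigenvalue (hQ : IntervalIntegrable Q volume 0 1)
    (hκ : ∀ i, (κ i).re = 1) (hμ : ∀ i, κ i ^ 2 = -(μ * w i))
    (hΨ : ∀ z, SolvesLinearODE (slMatrix Q w z) 1 (Ψ z)) (hΨ0 : ∀ z, Ψ z 0 = 1)
    (hT : Tᴴ = T) (hT2 : T * T = T) :
    ∀ᶠ s : ℝ in atTop, ¬ IsSLEigenvalue Q w T ((s ^ 2 : ℝ) * μ) := by
  filter_upwards [eventually_gt_atTop 0,
    eventually_isUnit_initialMatrix hQ hκ hμ hΨ hΨ0 hT hT2] with s hs hus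
  have hs' : (s : ℂ) ≠ 0 := by exact_mod_cast hs.ne'
  exact (not_isSLEigenvalue_and_weylMatrix_eq hQ (hΨ _) (hΨ0 _) hT2 hs'
    (isUnit_toRows_of_initialMatrix hus)).1

end RayWeyl

/-! ### The transfer matrix: limits on rays, growth, and recovery of the potential. -/

section Transfer

open scoped Matrix.Norms.L2Operator
open Filter Topology

variable {Q Qt : ℝ → Matrix (Fin 2) (Fin 2) ℂ} {w : Fin 2 → ℂ} {T : Matrix (Fin 2) (Fin 2) ℂ}
  {Ψ Ψt : ℂ → ℝ → Matrix (Fin 2 ⊕ Fin 2) (Fin 2 ⊕ Fin 2) ℂ} {κ : Fin 2 → ℂ} {μ z : ℂ} {x r : ℝ}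

theorem exists_fundamental (hQ : IntervalIntegrable Q volume 0 1) (w : Fin 2 → ℂ) :
    ∃ Ψ : ℂ → ℝ → Matrix (Fin 2 ⊕ Fin 2) (Fin 2 ⊕ Fin 2) ℂ,
      (∀ z, SolvesLinearODE (slMatrix Q w z) 1 (Ψ z)) ∧ (∀ z, Ψ z 0 = 1) ∧
        ∀ x, Differentiable ℂ fun z => Ψ z x := by
  obtain ⟨Ψ, hc, he, hd⟩ := exists_entire_fundamental
    (slMatrix Q w 0) (fun _ => Matrix.fromBlocks 0 0 (-Matrix.diagonal w) 0)
    (intervalIntegrable_slMatrix hQ w 0) intervalIntegrable_const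
  have h0 : ∀ z, Ψ z 0 = 1 := fun z => by
    rw [he z 0 (left_mem_Icc.2 zero_le_one), intervalIntegral.integral_same, add_zero]
  have hA : ∀ z t, slMatrix Q w 0 t + z • Matrix.fromBlocks 0 0 (-Matrix.diagonal w) 0
      = slMatrix Q w z t := fun z t => by
    rw [slMatrix, slMatrix, Matrix.fromBlocks_smul, Matrix.fromBlocks_add]
    congr 1
    · simp
    · simp
    · rw [smul_neg, zero_smul, sub_zero, sub_eq_add_neg]
    · simp
  refine ⟨Ψ, fun z => ⟨hc z, fun x hx => ?_⟩, h0, hd⟩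
  rw [h0, he z x hx]
  simp only [hA]

theorem isUnit_fundamental {u : ℝ → Matrix (Fin 2 ⊕ Fin 2) (Fin 2 ⊕ Fin 2) ℂ}
    (hQ : IntervalIntegrable Q volume 0 1) (hu : SolvesLinearODE (slMatrix Q w z) 1 u)
    (hu0 : u 0 = 1) (hx : x ∈ Icc (0 : ℝ) 1) : IsUnit (u x) :=
  (hu.mono hx.2).isUnit ((intervalIntegrable_slMatrix hQ w z).mono_set (by
    rw [uIcc_of_le hx.1, uIcc_of_le zero_le_one]; exact Icc_subset_Icc_right hx.2)) hu0 hx.1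

/-- The transfer matrix between two problems with the same Weyl matrix tends to `1` in the split
variables. -/
theorem tendsto_split_transfer (hQ : IntervalIntegrable Q volume 0 1)
    (hQt : IntervalIntegrable Qt volume 0 1) (hκ : ∀ i, (κ i).re = 1)
    (hμ : ∀ i, κ i ^ 2 = -(μ * w i))
    (hΨ : ∀ z, SolvesLinearODE (slMatrix Q w z) 1 (Ψ z)) (hΨ0 : ∀ z, Ψ z 0 = 1)
    (hΨt : ∀ z, SolvesLinearODE (slMatrix Qt w z) 1 (Ψt z)) (hΨt0 : ∀ z, Ψt z 0 = 1)
    (hT : Tᴴ = T) (hT2 : T * T = T)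
    (hM : ∀ z : ℂ, ¬ IsSLEigenvalue Q w T z → ¬ IsSLEigenvalue Qt w T z →
      weylMatrix Q w T z = weylMatrix Qt w T z) (hx : x ∈ Ioo (0 : ℝ) 1) :
    Tendsto (fun s : ℝ => splitMatrix κ s * (Ψ ((s ^ 2 : ℝ) * μ) x *
      (Ψt ((s ^ 2 : ℝ) * μ) x)⁻¹) * splitMatrixInv κ s - 1) atTop (𝓝 0) := by
  have h1 := tendsto_split_mul_weylData hQ hκ hμ hΨ hΨ0 hT hT2 hx
  have h2 := tendsto_split_mul_weylData hQt hκ hμ hΨt hΨt0 hT hT2 hx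
  have hU : ∀ᶠ s : ℝ in atTop, ‖leadingTerm κ (-(s * x))‖ ≤ 1 :=
    Filter.Eventually.of_forall fun s => norm_leadingTerm_le hκ _
  have h12 := h1.sub h2
  simp only [sub_sub_sub_cancel_right, sub_zero] at h12
  -- With G = `splitMatrix` and U the inverse leading term, GΨ̃Z̃U → I has a bounded inverse. Once Z
  -- = Z̃, the conjugated transfer matrix minus I is (GΨZ - GΨ̃Z)U, which tends to 0, times that
  -- inverse.
  have h3 := Matrix.tendsto_mul_zero_of_bounded_right h12 hU
  have h4 := (Matrix.tendsto_mul_zero_of_bounded_right h2 hU).add_const 1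
  rw [zero_add] at h4
  have h5 := (NormedRing.inverse_continuousAt
    (1 : (Matrix (Fin 2 ⊕ Fin 2) (Fin 2 ⊕ Fin 2) ℂ)ˣ)).tendsto.comp h4
  have h6 := Matrix.tendsto_mul_zero_of_bounded_right h3 (eventually_norm_le_of_tendsto h5)
  refine h6.congr' ?_
  filter_upwards [eventually_gt_atTop 0, eventually_not_isSLEigenvalue hQ hκ hμ hΨ hΨ0 hT hT2,
    eventually_not_isSLEigenvalue hQt hκ hμ hΨt hΨt0 hT hT2,
    h4.eventually (Units.isOpen.mem_nhds isUnit_one)] with s hs he het hu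
  have hG := splitMatrixInv_mul_splitMatrix (ne_zero_of_re_eq_one hκ) hs.ne'
  have hut := (Matrix.isUnit_iff_isUnit_det _).1 
    (isUnit_fundamental hQt (hΨt ((s ^ 2 : ℝ) * μ)) (hΨt0 _) (Ioo_subset_Icc_self hx))
  have hud := (Matrix.isUnit_iff_isUnit_det _).1 hu
  -- Equality of the Weyl matrices enters here: it makes the initial data Z common, so that they
  -- cancel in the quotient.
  rw [hM _ he het]
  set Z := weylData (weylMatrix Qt w T ((s ^ 2 : ℝ) * μ)) κ x s
  have hH : (splitMatrix κ s * Ψt ((s ^ 2 : ℝ) * μ) x * Z - leadingTerm κ (s * x))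
      * leadingTerm κ (-(s * x)) + 1
      = splitMatrix κ s * Ψt ((s ^ 2 : ℝ) * μ) x * Z * leadingTerm κ (-(s * x)) := by
    rw [Matrix.sub_mul, leadingTerm_mul_leadingTerm_neg, sub_add_cancel]
  have hP : (splitMatrix κ s * Ψ ((s ^ 2 : ℝ) * μ) x * Z
      - splitMatrix κ s * Ψt ((s ^ 2 : ℝ) * μ) x * Z) * leadingTerm κ (-(s * x))
      = (splitMatrix κ s * (Ψ ((s ^ 2 : ℝ) * μ) x * (Ψt ((s ^ 2 : ℝ) * μ) x)⁻¹)
          * splitMatrixInv κ s - 1) *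
        ((splitMatrix κ s * Ψt ((s ^ 2 : ℝ) * μ) x * Z - leadingTerm κ (s * x))
          * leadingTerm κ (-(s * x)) + 1) := by
    rw [hH, Matrix.sub_mul, Matrix.sub_mul, Matrix.one_mul]
    congr 1
    simp only [Matrix.mul_assoc]
    rw [← Matrix.mul_assoc (splitMatrixInv κ s), hG, Matrix.one_mul,
      Matrix.nonsing_inv_mul_cancel_left _ _ hut]
  rw [hP, Function.comp_apply, ← Matrix.nonsing_inv_eq_ringInverse,
    Matrix.mul_nonsing_inv_cancel_right _ _ hud]

/-- No positive power of s appears in the upper block row, so E → 0 suffices for its limit. The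
lower left block would carry a factor s, which is why only the upper row of the transfer matrix is
followed. -/
theorem splitMatrixInv_mul_mul_splitMatrix_inl (hκ : ∀ i, κ i ≠ 0) {s : ℝ} (hs : s ≠ 0)
    (E : Matrix (Fin 2 ⊕ Fin 2) (Fin 2 ⊕ Fin 2) ℂ) (i j : Fin 2) :
    (splitMatrixInv κ s * E * splitMatrix κ s) (Sum.inl i) (Sum.inl j)
      = (2 * κ i)⁻¹ * (E (Sum.inl i) (Sum.inl j) - E (Sum.inr i) (Sum.inl j)
        - E (Sum.inl i) (Sum.inr j) + E (Sum.inr i) (Sum.inr j)) * κ j ∧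
    (splitMatrixInv κ s * E * splitMatrix κ s) (Sum.inl i) (Sum.inr j)
      = (s : ℂ)⁻¹ * ((2 * κ i)⁻¹ * (E (Sum.inl i) (Sum.inl j) - E (Sum.inr i) (Sum.inl j)
        + E (Sum.inl i) (Sum.inr j) - E (Sum.inr i) (Sum.inr j))) := by
  have hs' : (s : ℂ) ≠ 0 := by exact_mod_cast hs
  have hi := hκ i
  rw [← Matrix.fromBlocks_toBlocks E, splitMatrix, splitMatrixInv, Matrix.fromBlocks_multiply,
    Matrix.fromBlocks_multiply]
  constructor <;> simp [Matrix.add_mul, Matrix.diagonal_mul, Matrix.mul_diagonal] <;> field_simp <;>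
    ring

theorem tendsto_transfer (hκ : ∀ i, (κ i).re = 1) {P : ℝ → Matrix (Fin 2 ⊕ Fin 2) (Fin 2 ⊕ Fin 2) ℂ}
    (hP : Tendsto (fun s => splitMatrix κ s * P s * splitMatrixInv κ s - 1) atTop (𝓝 0))
    (i : Fin 2) (k : Fin 2 ⊕ Fin 2) : Tendsto (fun s => P s (Sum.inl i) k) atTop
      (𝓝 ((1 : Matrix (Fin 2 ⊕ Fin 2) (Fin 2 ⊕ Fin 2) ℂ) (Sum.inl i) k)) := by
  set E := fun s => splitMatrix κ s * P s * splitMatrixInv κ s - 1 with hE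
  have hent : ∀ a b, Tendsto (fun s => E s a b) atTop (𝓝 0) := fun a b =>
    tendsto_pi_nhds.1 (tendsto_pi_nhds.1 hP a) b
  have hκ0 := ne_zero_of_re_eq_one hκ
  have hPE : ∀ᶠ s : ℝ in atTop, P s = 1 + splitMatrixInv κ s * E s * splitMatrix κ s := by
    filter_upwards [eventually_gt_atTop 0] with s hs
    have hG := splitMatrixInv_mul_splitMatrix hκ0 hs.ne'
    rw [hE]
    simp only [Matrix.mul_sub, Matrix.sub_mul, Matrix.mul_one, hG, Matrix.mul_assoc]
    rw [← Matrix.mul_assoc (splitMatrixInv κ s), hG, Matrix.one_mul, add_sub_cancel]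
  rcases k with j | j
  · have h := ((((((hent (Sum.inl i) (Sum.inl j)).sub (hent (Sum.inr i) (Sum.inl j))).sub
      (hent (Sum.inl i) (Sum.inr j))).add (hent (Sum.inr i) (Sum.inr j))).const_mul
        (2 * κ i)⁻¹).mul_const (κ j)).const_add
        ((1 : Matrix (Fin 2 ⊕ Fin 2) (Fin 2 ⊕ Fin 2) ℂ) (Sum.inl i) (Sum.inl j))
    simp only [sub_zero, add_zero, mul_zero, zero_mul] at h
    refine h.congr' ?_
    filter_upwards [hPE, eventually_gt_atTop 0] with s hs hs0
    rw [hs, Matrix.add_apply, (splitMatrixInv_mul_mul_splitMatrix_inl hκ0 hs0.ne' _ i j).1]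
  · have hi : Tendsto (fun s : ℝ => (s : ℂ)⁻¹) atTop (𝓝 0) := by
      rw [← Complex.ofReal_zero]
      exact ((Complex.continuous_ofReal.tendsto 0).comp tendsto_inv_atTop_zero).congr
        Complex.ofReal_inv
    have h := (hi.mul ((((((hent (Sum.inl i) (Sum.inl j)).sub (hent (Sum.inr i) (Sum.inl j))).add
      (hent (Sum.inl i) (Sum.inr j))).sub (hent (Sum.inr i) (Sum.inr j))).const_mul
        (2 * κ i)⁻¹))).const_add
        ((1 : Matrix (Fin 2 ⊕ Fin 2) (Fin 2 ⊕ Fin 2) ℂ) (Sum.inl i) (Sum.inr j))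
    simp only [sub_zero, add_zero, mul_zero] at h
    refine h.congr' ?_
    filter_upwards [hPE, eventually_gt_atTop 0] with s hs hs0
    rw [hs, Matrix.add_apply, (splitMatrixInv_mul_mul_splitMatrix_inl hκ0 hs0.ne' _ i j).2]

theorem exists_norm_fromBlocks_antidiagonal_le : ∃ c : ℝ, 0 ≤ c ∧
    ∀ A B : Matrix (Fin 2) (Fin 2) ℂ, ‖Matrix.fromBlocks 0 A B 0‖ ≤ c * (‖A‖ + ‖B‖) := by
  set R₁ : Matrix (Fin 2 ⊕ Fin 2) (Fin 2) ℂ := Matrix.fromRows 1 0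
  set R₂ : Matrix (Fin 2 ⊕ Fin 2) (Fin 2) ℂ := Matrix.fromRows 0 1
  set C₁ : Matrix (Fin 2) (Fin 2 ⊕ Fin 2) ℂ := Matrix.fromCols 1 0
  set C₂ : Matrix (Fin 2) (Fin 2 ⊕ Fin 2) ℂ := Matrix.fromCols 0 1
  refine ⟨‖R₁‖ * ‖C₂‖ + ‖R₂‖ * ‖C₁‖, by positivity, fun A B => ?_⟩
  have h : Matrix.fromBlocks 0 A B 0 = R₁ * A * C₂ + R₂ * B * C₁ := by
    simp only [R₁, R₂, C₁, C₂, Matrix.fromRows_mul, Matrix.mul_fromCols, Matrix.one_mul,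
      Matrix.zero_mul, Matrix.mul_one, Matrix.mul_zero]
    ext (i | i) (j | j) <;> simp
  have hb : ∀ (X : Matrix (Fin 2 ⊕ Fin 2) (Fin 2) ℂ) (Y : Matrix (Fin 2) (Fin 2) ℂ)
      (Z : Matrix (Fin 2) (Fin 2 ⊕ Fin 2) ℂ), ‖X * Y * Z‖ ≤ ‖X‖ * ‖Z‖ * ‖Y‖ := fun X Y Z => by
    refine (Matrix.l2_opNorm_mul _ _).trans ?_
    rw [mul_right_comm]
    exact mul_le_mul_of_nonneg_right (Matrix.l2_opNorm_mul _ _) (norm_nonneg _)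
  rw [h]
  refine (norm_add_le _ _).trans ((add_le_add (hb _ _ _) (hb _ _ _)).trans ?_)
  nlinarith [norm_nonneg A, norm_nonneg B, mul_nonneg (norm_nonneg R₁) (norm_nonneg C₂),
    mul_nonneg (norm_nonneg R₂) (norm_nonneg C₁),
    mul_nonneg (mul_nonneg (norm_nonneg R₁) (norm_nonneg C₂)) (norm_nonneg B),
    mul_nonneg (mul_nonneg (norm_nonneg R₂) (norm_nonneg C₁)) (norm_nonneg A)]

/-- The passage from `(Y, Y')` to `(Y, Y' / r)`. -/
noncomputable def scaleMatrix (r : ℝ) : Matrix (Fin 2 ⊕ Fin 2) (Fin 2 ⊕ Fin 2) ℂ :=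
  Matrix.fromBlocks 1 0 0 ((r : ℂ)⁻¹ • 1)

/-- The inverse of `scaleMatrix`. -/
noncomputable def scaleMatrixInv (r : ℝ) : Matrix (Fin 2 ⊕ Fin 2) (Fin 2 ⊕ Fin 2) ℂ :=
  Matrix.fromBlocks 1 0 0 ((r : ℂ) • 1)

theorem scaleMatrixInv_mul_scaleMatrix (hr : r ≠ 0) : scaleMatrixInv r * scaleMatrix r = 1 := by
  have hr' : (r : ℂ) ≠ 0 := by exact_mod_cast hr
  rw [scaleMatrix, scaleMatrixInv, Matrix.fromBlocks_multiply, ← Matrix.fromBlocks_one]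
  congr 1
  · simp
  · simp
  · simp
  · rw [Matrix.zero_mul, zero_add, Matrix.smul_mul, Matrix.one_mul, smul_smul,
      mul_inv_cancel₀ hr', one_smul]

theorem scaleMatrix_mul_slMatrix_mul (t : ℝ) :
    scaleMatrix r * slMatrix Q w z t * scaleMatrixInv r = Matrix.fromBlocks 0 ((r : ℂ) • 1)
      ((r : ℂ)⁻¹ • (Q t - z • Matrix.diagonal w)) 0 := by
  rw [scaleMatrix, scaleMatrixInv, slMatrix, Matrix.fromBlocks_multiply,
    Matrix.fromBlocks_multiply]
  simp

/-- Exponential type of the fundamental matrix with respect to the square root of the spectral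
parameter. -/
theorem exists_norm_scale_fundamental_le (hQ : IntervalIntegrable Q volume 0 1) (w : Fin 2 → ℂ) :
    ∃ B C : ℝ, ∀ r : ℝ, 1 ≤ r → ∀ z : ℂ, ‖z‖ ≤ r ^ 2 →
      ∀ u : ℝ → Matrix (Fin 2 ⊕ Fin 2) (Fin 2 ⊕ Fin 2) ℂ,
        SolvesLinearODE (slMatrix Q w z) 1 u → u 0 = 1 → ∀ x ∈ Icc (0 : ℝ) 1,
          ‖scaleMatrix r * u x * scaleMatrixInv r‖ ≤ Real.exp (B * r + C) ∧
            ‖scaleMatrix r * (u x)⁻¹ * scaleMatrixInv r‖ ≤ Real.exp (B * r + C) := by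
  obtain ⟨c, hc, hcb⟩ := exists_norm_fromBlocks_antidiagonal_le
  refine ⟨c * (1 + ‖Matrix.diagonal w‖), c * ∫ t in (0 : ℝ)..1, ‖Q t‖,
    fun r hr z hz u hu hu0 x hx => ?_⟩
  have hr0 : 0 < r := one_pos.trans_le hr
  have hA := intervalIntegrable_slMatrix hQ w z
  have hD := scaleMatrixInv_mul_scaleMatrix hr0.ne'
  have hD' : scaleMatrix r * scaleMatrixInv r = 1 := mul_eq_one_comm.1 hD
  have hA' : IntervalIntegrable (fun t => scaleMatrix r * slMatrix Q w z t * scaleMatrixInv r)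
      volume 0 1 := by
    have h : IntervalIntegrable (fun t => (r : ℂ)⁻¹ • (Q t - z • Matrix.diagonal w)) volume 0 1 :=
      (hQ.sub intervalIntegrable_const).smul (r : ℂ)⁻¹
    simp only [scaleMatrix_mul_slMatrix_mul]
    exact Matrix.intervalIntegrable_fromBlocks intervalIntegrable_const intervalIntegrable_const
      h intervalIntegrable_const
  have hv := (hu.conj hA hD).mul_right hA' (scaleMatrixInv r)
  have hv0 : scaleMatrix r * u 0 * scaleMatrixInv r = 1 := by rw [hu0, Matrix.mul_one, hD']
  have hsub : uIcc 0 x ⊆ uIcc (0 : ℝ) 1 := by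
    rw [uIcc_of_le hx.1, uIcc_of_le zero_le_one]; exact Icc_subset_Icc_right hx.2
  have hAx := hA'.mono_set hsub
  -- Scaling Y' by 1/r balances the blocks: they become r and (Q - zW)/r, both O(r) + ‖Q‖ as |z| ≤
  -- r² and r ≥ 1. Grönwall then gives exponential type in r, that is, order 1/2 in z.
  have hpt : ∀ t, ‖scaleMatrix r * slMatrix Q w z t * scaleMatrixInv r‖
      ≤ c * (1 + ‖Matrix.diagonal w‖) * r + c * ‖Q t‖ := fun t => by
    rw [scaleMatrix_mul_slMatrix_mul]
    refine (hcb _ _).trans ?_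
    rw [norm_smul, norm_smul, norm_one, norm_inv, Complex.norm_real, Real.norm_of_nonneg hr0.le]
    have h1 : ‖Q t - z • Matrix.diagonal w‖ ≤ ‖Q t‖ + r ^ 2 * ‖Matrix.diagonal w‖ := by
      refine (norm_sub_le _ _).trans (add_le_add_right ?_ _)
      rw [norm_smul]
      exact mul_le_mul_of_nonneg_right hz (norm_nonneg _)
    have h2 : r⁻¹ * ‖Q t - z • Matrix.diagonal w‖ ≤ ‖Q t‖ + r * ‖Matrix.diagonal w‖ := by
      rw [inv_mul_le_iff₀ hr0]
      nlinarith [mul_nonneg (sub_nonneg.2 hr) (norm_nonneg (Q t))]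
    calc c * (r * 1 + r⁻¹ * ‖Q t - z • Matrix.diagonal w‖)
        ≤ c * (r * 1 + (‖Q t‖ + r * ‖Matrix.diagonal w‖)) := by gcongr
      _ = _ := by ring
  have hint : ∫ t in (0 : ℝ)..x, ‖scaleMatrix r * slMatrix Q w z t * scaleMatrixInv r‖
      ≤ c * (1 + ‖Matrix.diagonal w‖) * r + c * ∫ t in (0 : ℝ)..1, ‖Q t‖ := by
    calc _ ≤ ∫ t in (0 : ℝ)..1, ‖scaleMatrix r * slMatrix Q w z t * scaleMatrixInv r‖ :=
          intervalIntegral.integral_mono_interval le_rfl hx.1 hx.2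
            (Filter.Eventually.of_forall fun t => norm_nonneg _) hA'.norm
      _ ≤ ∫ t in (0 : ℝ)..1, (c * (1 + ‖Matrix.diagonal w‖) * r + c * ‖Q t‖) :=
          intervalIntegral.integral_mono_on zero_le_one hA'.norm
            (intervalIntegrable_const.add (hQ.norm.const_mul c)) fun t _ => hpt t
      _ = _ := by
          rw [intervalIntegral.integral_add intervalIntegrable_const (hQ.norm.const_mul c),
            intervalIntegral.integral_const_mul]
          simp
  have hud := (Matrix.isUnit_iff_isUnit_det _).1 (isUnit_fundamental hQ hu hu0 hx)
  have hinv : (scaleMatrix r * u x * scaleMatrixInv r)⁻¹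
      = scaleMatrix r * (u x)⁻¹ * scaleMatrixInv r := by
    refine Matrix.inv_eq_right_inv ?_
    simp only [Matrix.mul_assoc]
    rw [← Matrix.mul_assoc (scaleMatrixInv r), hD, Matrix.one_mul,
      Matrix.mul_nonsing_inv_cancel_left _ _ hud, hD']
  constructor
  · have h := (hv.mono hx.2).norm_le hx.1 hAx
    rw [hv0, norm_one, one_mul] at h
    exact h.trans (Real.exp_le_exp.2 hint)
  · have h := (hv.mono hx.2).norm_inv_le hAx hv0 hx.1
    rw [hinv] at h
    exact h.trans (Real.exp_le_exp.2 hint)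

/-- Conjugation by `scaleMatrix` keeps the upper left block and multiplies the upper right one by r
≥ 1, so bounds on the scaled matrix pass to the upper row. -/
theorem exists_norm_transfer_le (hQ : IntervalIntegrable Q volume 0 1)
    (hQt : IntervalIntegrable Qt volume 0 1)
    (hΨ : ∀ z, SolvesLinearODE (slMatrix Q w z) 1 (Ψ z)) (hΨ0 : ∀ z, Ψ z 0 = 1)
    (hΨt : ∀ z, SolvesLinearODE (slMatrix Qt w z) 1 (Ψt z)) (hΨt0 : ∀ z, Ψt z 0 = 1)
    (hx : x ∈ Icc (0 : ℝ) 1) (i : Fin 2) (k : Fin 2 ⊕ Fin 2) :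
    ∃ B C : ℝ, ∀ r : ℝ, 1 ≤ r → ∀ z : ℂ, ‖z‖ ≤ r ^ 2 →
      ‖(Ψ z x * (Ψt z x)⁻¹) (Sum.inl i) k‖ ≤ C * Real.exp (B * r) := by
  obtain ⟨B, C, hB⟩ := exists_norm_scale_fundamental_le hQ w
  obtain ⟨B', C', hB'⟩ := exists_norm_scale_fundamental_le hQt w
  set L := LinearMap.toContinuousLinearMap
    (Matrix.entryLinearMap (m := Fin 2 ⊕ Fin 2) (n := Fin 2 ⊕ Fin 2) ℂ ℂ (Sum.inl i) k)
  refine ⟨B + B', ‖L‖ * Real.exp (C + C'), fun r hr z hz => ?_⟩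
  have hr0 : 0 < r := one_pos.trans_le hr
  have hr' : (r : ℂ) ≠ 0 := by exact_mod_cast hr0.ne'
  have hD := scaleMatrixInv_mul_scaleMatrix hr0.ne'
  set P := Ψ z x * (Ψt z x)⁻¹
  have hP : scaleMatrix r * P * scaleMatrixInv r = (scaleMatrix r * Ψ z x * scaleMatrixInv r)
      * (scaleMatrix r * (Ψt z x)⁻¹ * scaleMatrixInv r) := by
    simp only [P, Matrix.mul_assoc]
    rw [← Matrix.mul_assoc (scaleMatrixInv r) (scaleMatrix r), hD, Matrix.one_mul]
  have hn : ‖scaleMatrix r * P * scaleMatrixInv r‖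
      ≤ Real.exp (B * r + C) * Real.exp (B' * r + C') := by
    rw [hP]
    exact (Matrix.l2_opNorm_mul _ _).trans (mul_le_mul (hB r hr z hz _ (hΨ z) (hΨ0 z) x hx).1
      (hB' r hr z hz _ (hΨt z) (hΨt0 z) x hx).2 (norm_nonneg _) (Real.exp_pos _).le)
  have hent : ‖P (Sum.inl i) k‖ ≤ ‖(scaleMatrix r * P * scaleMatrixInv r) (Sum.inl i) k‖ := by
    rw [← Matrix.fromBlocks_toBlocks P, scaleMatrix, scaleMatrixInv, Matrix.fromBlocks_multiply,
      Matrix.fromBlocks_multiply]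
    rcases k with j | j
    · simp
    · simp only [Matrix.fromBlocks_apply₁₂, Matrix.one_mul, Matrix.zero_mul, Matrix.mul_zero,
        add_zero, zero_add, Matrix.mul_smul, Matrix.mul_one, Matrix.smul_apply, norm_smul,
        Complex.norm_real, Real.norm_of_nonneg hr0.le]
      exact le_mul_of_one_le_left (norm_nonneg _) hr
  calc ‖P (Sum.inl i) k‖ ≤ ‖L (scaleMatrix r * P * scaleMatrixInv r)‖ := hent
    _ ≤ ‖L‖ * (Real.exp (B * r + C) * Real.exp (B' * r + C')) :=
        (L.le_opNorm _).trans (mul_le_mul_of_nonneg_left hn (norm_nonneg _))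
    _ = _ := by
        rw [← Real.exp_add, mul_assoc, ← Real.exp_add]
        ring_nf

theorem differentiable_transfer (hd : Differentiable ℂ fun z => Ψ z x)
    (hdt : Differentiable ℂ fun z => Ψt z x) (hu : ∀ z, IsUnit (Ψt z x))
    (i k : Fin 2 ⊕ Fin 2) : Differentiable ℂ fun z => (Ψ z x * (Ψt z x)⁻¹) i k := by
  have h : Differentiable ℂ fun z => Ψ z x * (Ψt z x)⁻¹ := by
    simp only [Matrix.nonsing_inv_eq_ringInverse]
    exact hd.mul fun z => (hdt z).inverse (hu z)
  exact (LinearMap.toContinuousLinearMap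
    (Matrix.entryLinearMap (m := Fin 2 ⊕ Fin 2) (n := Fin 2 ⊕ Fin 2) ℂ ℂ i k)).differentiable.comp h

/-- Equal upper halves have equal derivatives, so the two equations share a full system of
solutions, and enough of them exist at each point to determine the potential. -/
theorem SolvesLinearODE.ae_eq_of_toRows_eq
    {u v : ℝ → Matrix (Fin 2 ⊕ Fin 2) (Fin 2 ⊕ Fin 2) ℂ} (hQ : IntervalIntegrable Q volume 0 1)
    (hQt : IntervalIntegrable Qt volume 0 1) (hu : SolvesLinearODE (slMatrix Q w z) 1 u)
    (hu0 : u 0 = 1) (hv : SolvesLinearODE (slMatrix Qt w z) 1 v)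
    (huv : ∀ x ∈ Ioo (0 : ℝ) 1, (u x).toRows₁ = (v x).toRows₁) :
    ∀ᵐ x ∂(volume.restrict (Ioo (0 : ℝ) 1)), Q x = Qt x := by
  have hev : ∀ x ∈ Ioo (0 : ℝ) 1, ∀ᶠ t in 𝓝 x, t ∈ Ioo (0 : ℝ) 1 := fun x hx =>
    isOpen_Ioo.mem_nhds hx
  have h2 : ∀ x ∈ Ioo (0 : ℝ) 1, ∀ i j, u x (Sum.inr i) j = v x (Sum.inr i) j := by
    intro x hx i j
    have hn := Icc_mem_nhds hx.1 hx.2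
    have d1 := (hu.matDeriv_eq hQ i j (Ioo_subset_Icc_self hx)).hasDerivAt hn
    have d2 := (hv.matDeriv_eq hQt i j (Ioo_subset_Icc_self hx)).hasDerivAt hn
    refine d1.unique (d2.congr_of_eventuallyEq ?_)
    filter_upwards [hev x hx] with t ht
    exact congrFun (congrFun (huv t ht) i) j
  filter_upwards [hu.ae_hasDerivAt hQ, hv.ae_hasDerivAt hQt, ae_restrict_mem measurableSet_Ioo]
    with x h1x h2x hx
  have h3 : (Q x - z • Matrix.diagonal w) * (u x).toRows₁
      = (Qt x - z • Matrix.diagonal w) * (u x).toRows₁ := by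
    ext i j
    have d2 := h2x i j
    rw [← huv x hx] at d2
    refine (h1x i j).unique (d2.congr_of_eventuallyEq ?_)
    filter_upwards [hev x hx] with t ht
    exact h2 t ht i j
  have hud := (Matrix.isUnit_iff_isUnit_det _).1 
    (isUnit_fundamental hQ hu hu0 (Ioo_subset_Icc_self hx))
  -- The upper two rows of an invertible matrix have a right inverse, so the potential can be
  -- cancelled free even where individual 2 × 2 solutions are singular.
  have h4 : (u x).toRows₁ * ((u x)⁻¹).toCols₁ = 1 := by
    ext i j
    have := congrFun (congrFun (Matrix.mul_nonsing_inv _ hud) (Sum.inl i)) (Sum.inl j)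
    rw [Matrix.mul_apply] at this ⊢
    simpa [Matrix.one_apply] using this
  have h5 := congrArg (· * ((u x)⁻¹).toCols₁) h3
  simp only [Matrix.mul_assoc, h4, Matrix.mul_one] at h5
  exact sub_left_injective h5

end Transfer

theorem mainTheorem1 (Q Qt : ℝ → Matrix (Fin 2) (Fin 2) ℂ) (w : Fin 2 → ℂ)
    (T : Matrix (Fin 2) (Fin 2) ℂ)
    (hQ : ∀ i j, IntegrableOn (fun x => Q x i j) (Ioo (0 : ℝ) 1) volume)
    (hQt : ∀ i j, IntegrableOn (fun x => Qt x i j) (Ioo (0 : ℝ) 1) volume)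
    (hw : w 0 * w 1 ≠ 0) (harg : Complex.arg (w 0) ≠ Complex.arg (w 1))
    (hT : Tᴴ = T) (hT2 : T * T = T)
    (hM : ∀ z : ℂ, ¬ IsSLEigenvalue Q w T z → ¬ IsSLEigenvalue Qt w T z →
      weylMatrix Q w T z = weylMatrix Qt w T z) :
    ∀ᵐ x ∂(volume.restrict (Ioo (0 : ℝ) 1)), Q x = Qt x := by
  have hQ' := intervalIntegrable_of_entries hQ
  have hQt' := intervalIntegrable_of_entries hQt
  obtain ⟨Ψ, hΨ, hΨ0, hd⟩ := exists_fundamental hQ' w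
  obtain ⟨Ψt, hΨt, hΨt0, hdt⟩ := exists_fundamental hQt' w
  obtain ⟨μ, ν, hμ0, hν0, hμν, ⟨κ, hκ⟩, ⟨κ', hκ'⟩⟩ := exists_two_rays hw harg
  -- The upper row of the transfer matrix is constant in z, so any single value recovers the
  -- potential; z = 0 is taken.
  refine (hΨ 0).ae_eq_of_toRows_eq hQ' hQt' (hΨ0 0) (hΨt 0) fun x hx => ?_
  have hu : ∀ z, IsUnit (Ψt z x) := fun z =>
    isUnit_fundamental hQt' (hΨt z) (hΨt0 z) (Ioo_subset_Icc_self hx)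
  have hP : ∀ i k, (Ψ 0 x * (Ψt 0 x)⁻¹) (Sum.inl i) k
      = (1 : Matrix (Fin 2 ⊕ Fin 2) (Fin 2 ⊕ Fin 2) ℂ) (Sum.inl i) k := fun i k => by
    obtain ⟨B, C, hBC⟩ := exists_norm_transfer_le hQ' hQt' hΨ hΨ0 hΨt hΨt0
      (Ioo_subset_Icc_self hx) i k
    exact eq_of_tendsto_on_two_rays (differentiable_transfer (hd x) (hdt x) hu _ k) hBC hμ0 hν0 hμν
      (tendsto_transfer (fun i => (hκ i).2) (tendsto_split_transfer hQ' hQt' (fun i => (hκ i).2)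
        (fun i => (hκ i).1) hΨ hΨ0 hΨt hΨt0 hT hT2 hM hx) i k)
      (tendsto_transfer (fun i => (hκ' i).2) (tendsto_split_transfer hQ' hQt' (fun i => (hκ' i).2)
        (fun i => (hκ' i).1) hΨ hΨ0 hΨt hΨt0 hT hT2 hM hx) i k) 0
  have hrows : (Ψ 0 x * (Ψt 0 x)⁻¹).toRows₁
      = (1 : Matrix (Fin 2 ⊕ Fin 2) (Fin 2 ⊕ Fin 2) ℂ).toRows₁ := by
    ext i k
    exact hP i k
  have hmul : ∀ A B : Matrix (Fin 2 ⊕ Fin 2) (Fin 2 ⊕ Fin 2) ℂ,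
      (A * B).toRows₁ = A.toRows₁ * B := fun A B => rfl
  have hΨx : Ψ 0 x = Ψ 0 x * (Ψt 0 x)⁻¹ * Ψt 0 x :=
    (Matrix.nonsing_inv_mul_cancel_right _ _ ((Matrix.isUnit_iff_isUnit_det _).1 (hu 0))).symm
  rw [hΨx, hmul, hrows, ← hmul, Matrix.one_mul]
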